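/- Let $\mathcal{AP}_{3,3}$ be the set of absolutely PPT two-qutrit states, i.e. of all positive semidefinite matrices $\rho$ on $\mathbb{C}^3\otimes\mathbb{C}^3$ with $\operatorname{tr}\rho=1$ such that, for every unitary $U$ on $\mathbb{C}^3\otimes\mathbb{C}^3$, the partial transpose of $U\rho U^\dagger$ is positive semidefinite. Call $\rho\in\mathcal{AP}_{3,3}$ an interior point if $\frac{1}{1-\epsilon}\left(\rho-\frac{\epsilon}{9}I_9\right)\in\mathcal{AP}_{3,3}$ for some $0<\epsilon<1$, and a boundary point otherwise. Let $\lambda(\rho)=(\lambda_1,\dots,\lambda_9)$ be the vector of eigenvalues of $\rho$, counted with multiplicity, in nonincreasing order, and let $$l_1(\lambda)=\det\begin{bmatrix}2\lambda_9&\lambda_8-\lambda_1&\lambda_6-\lambda_2\\ \lambda_8-\lambda_1&2\lambda_7&\lambda_5-\lambda_3\\ \lambda_6-\lambda_2&\lambda_5-\lambda_3&2\lambda_4\end{bmatrix}.$$ **Lemma.** Let $\rho$ be a full-rank boundary point of $\mathcal{AP}_{3,3}$ that has exactly three distinct eigenvalues and whose largest eigenvalue is simple (so that $\lambda(\rho)=(a,b,\dots,b,c,\dots,c)$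 with $a>b>c>0$). Then $\rho$ is an extreme point of $\mathcal{AP}_{3,3}$, unless $\lambda(\rho)=(3c,b,b,b,b,b,c,c,c)$ for some $3c>b>c>0$, with $l_1(\lambda(\rho))=0$. In that exceptional case, $\rho=\frac12(\alpha+\beta)$ for two distinct states $\alpha,\beta\in\mathcal{AP}_{3,3}$, so that $\rho$ is not an extreme point of $\mathcal{AP}_{3,3}$. -/

import Mathlib

open scoped ComplexOrder

/-- The partial transpose of a matrix on `ℂ^m ⊗ ℂ^n`, with the transposition on the second factor.
(Transposing the first factor instead gives the full transpose of this matrix, so that positive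
semidefiniteness does not depend on the choice.) -/
def partialTranspose {m n : ℕ} (ρ : Matrix (Fin m × Fin n) (Fin m × Fin n) ℂ) :
    Matrix (Fin m × Fin n) (Fin m × Fin n) ℂ :=
  Matrix.of fun p q => ρ (p.1, q.2) (q.1, p.2)

/-- Bipartite states on `ℂ^m ⊗ ℂ^n`: positive semidefinite matrices of trace one. -/
def IsState {m n : ℕ} (ρ : Matrix (Fin m × Fin n) (Fin m × Fin n) ℂ) : Prop :=
  ρ.PosSemidef ∧ ρ.trace = 1

/-- A state is PPT if its partial transpose is positive semidefinite. -/
def IsPPTState {m n : ℕ} (ρ : Matrix (Fin m × Fin n) (Fin m × Fin n) ℂ) : Prop :=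
  IsState ρ ∧ (partialTranspose ρ).PosSemidef

/-- The set of `m × n` absolutely PPT states: the PPT states `ρ` such that `U ρ U†` is a PPT state
for every global unitary `U`. -/
def absolutelyPPT (m n : ℕ) : Set (Matrix (Fin m × Fin n) (Fin m × Fin n) ℂ) :=
  {ρ | IsPPTState ρ ∧ ∀ U ∈ Matrix.unitaryGroup (Fin m × Fin n) ℂ, IsPPTState (U * ρ * star U)}

/-- Interior points: the absolutely PPT states that can be moved a little further away from the
maximally mixed state `I / (m n)` along the line through it. -/
def IsInteriorPoint {m n : ℕ} (ρ : Matrix (Fin m × Fin n) (Fin m × Fin n) ℂ) : Prop :=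
  ρ ∈ absolutelyPPT m n ∧ ∃ ε : ℝ, 0 < ε ∧ ε < 1 ∧
    (1 / (1 - ε)) •
      (ρ - (ε / ((m : ℝ) * (n : ℝ))) • (1 : Matrix (Fin m × Fin n) (Fin m × Fin n) ℂ)) ∈
        absolutelyPPT m n

/-- Boundary points: the absolutely PPT states that are not interior points. -/
def IsBoundaryPoint {m n : ℕ} (ρ : Matrix (Fin m × Fin n) (Fin m × Fin n) ℂ) : Prop :=
  ρ ∈ absolutelyPPT m n ∧ ¬ IsInteriorPoint ρ

theorem IsBoundaryPoint.isHermitian {m n : ℕ}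
    {ρ : Matrix (Fin m × Fin n) (Fin m × Fin n) ℂ} (h : IsBoundaryPoint ρ) : ρ.IsHermitian :=
  h.1.1.1.1.isHermitian

/-- The eigenvalue vector of a Hermitian matrix on `ℂ^3 ⊗ ℂ^3`: its nine eigenvalues, counted with
multiplicity, in nonincreasing order; entry `i` is the eigenvalue usually numbered `i + 1`. -/
noncomputable def eigenvalueVector {ρ : Matrix (Fin 3 × Fin 3) (Fin 3 × Fin 3) ℂ}
    (h : ρ.IsHermitian) : Fin 9 → ℝ :=
  fun i => h.eigenvalues₀ (Fin.cast (by simp) i)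

/-- The matrix `L_1(x)`, where `x i` is the entry `x_{i+1}`. -/
def L1 (x : Fin 9 → ℝ) : Matrix (Fin 3) (Fin 3) ℝ :=
  !![2 * x 8, x 7 - x 0, x 5 - x 1;
     x 7 - x 0, 2 * x 6, x 4 - x 2;
     x 5 - x 1, x 4 - x 2, 2 * x 3]

/-- The determinant `l_1(x)` of `L_1(x)`. -/
def l1 (x : Fin 9 → ℝ) : ℝ := (L1 x).det

/-- The exceptional eigenvalue vectors `(3c, b, b, b, b, b, c, c, c)` with `3c > b > c > 0`
and `l_1 = 0`. -/
def IsExceptional (x : Fin 9 → ℝ) : Prop :=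
  (∃ b c : ℝ, 0 < c ∧ c < b ∧ b < 3 * c ∧ x = ![3 * c, b, b, b, b, b, c, c, c]) ∧ l1 x = 0

/-! The partial transpose of a rank-one matrix with Schmidt coefficients `s` has eigenvalues `s i ^
2` and `± s i * s j`. Hence absolute positivity of a state says that its spectrum, paired in every
order with these weights, gives a nonnegative number. By Birkhoff and rearrangement only oppositely
ordered pairings matter. For ordered `s` the order of the weights is known except for `s 0 * s 2`
against `s 1 ^ 2`, so two quadratic forms in `s` decide: half the form of `L1 x`, and the same with
entries 5 and 6 of the spectrum exchanged.

At a full-rank boundary point compactness yields a zero `s` of one form. That form is nonnegative on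
all of ℝ³, so `L1 x *ᵥ s = 0`. If `ρ` lies inside a segment, the forms of both endpoints vanish at
`s` too, in the eigenbasis of `ρ` and after any rotation preserving `ρ`. Since `L1 d *ᵥ s` combines
the gradients of the weights with coefficients `d k`, and these gradients are pairwise distinct
unless `s` is a multiple of `(1, 1, 0)`, the endpoints are diagonal and constant on the eigenspaces
of `ρ` (`diagonal_of_convex_combination`). The three remaining unknowns are fixed by the kernel
equations and the trace (`IsThreeStep.eq_of_L1_mulVec_eq_zero`).

A zero at `(1, 1, 0)` forces the spectrum `(3c, b, b, b, b, b, c, c, c)`. There the first form is `c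
(s₀ - s₁)² + b s₂²`, which stays nonnegative when `b` and `c` vary, so such a `ρ` is a midpoint. -/

/-! ### Spectral decompositions and Birkhoff averaging -/

open Matrix in
/-- The spectral theorem, with the eigenvalues listed along a prescribed enumeration. -/
theorem Matrix.IsHermitian.exists_unitary_conj_diagonal {n : Type*} [Fintype n] [DecidableEq n]
    {A : Matrix n n ℂ} (hA : A.IsHermitian) (e : Fin (Fintype.card n) ≃ n) :
    ∃ V ∈ unitaryGroup n ℂ,
      A = V * diagonal (fun i => (hA.eigenvalues₀ (e.symm i) : ℂ)) * star V := by
  -- `E` is the enumeration through which `eigenvalues` reads `eigenvalues₀`; permuting the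
  -- eigenvector columns by `σ` replaces it by `e`.
  set E : Fin (Fintype.card n) ≃ n := Fintype.equivOfCardEq (Fintype.card_fin _) with hE
  set σ : n ≃ n := e.symm.trans E with hσ
  set W : Matrix n n ℂ := (hA.eigenvectorUnitary : Matrix n n ℂ) with hW
  have hWu : star W * W = 1 := Unitary.coe_star_mul_self hA.eigenvectorUnitary
  have hsub : star (W.submatrix id σ) = (star W).submatrix σ id := by
    ext i j; simp [star_eq_conjTranspose]
  refine ⟨W.submatrix id σ, ?_, ?_⟩
  · rw [mem_unitaryGroup_iff', hsub, ← submatrix_mul _ _ σ id σ Function.bijective_id, hWu,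
      submatrix_one_equiv]
  · have hd : diagonal (fun i => (hA.eigenvalues₀ (e.symm i) : ℂ)) =
        (diagonal (fun i => (hA.eigenvalues i : ℂ))).submatrix σ σ := by
      rw [submatrix_diagonal_equiv]
      congr 1
      ext i
      simp [hσ, IsHermitian.eigenvalues, hE]
    rw [hd, hsub, submatrix_mul_equiv, submatrix_mul_equiv, submatrix_id_id]
    have := hA.spectral_theorem
    rw [Unitary.conjStarAlgAut_apply] at this
    exact this

open Matrix in
/-- A square matrix with orthogonal columns is a unitary times a diagonal matrix. -/
theorem Matrix.exists_unitary_mul_diagonal_of_orthogonal_columns {n : Type*} [Fintype n]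
    [DecidableEq n] {N : Matrix n n ℂ} {s : n → ℝ}
    (h : star N * N = diagonal (fun i => ((s i) ^ 2 : ℂ))) :
    ∃ A ∈ unitaryGroup n ℂ, N = A * diagonal (fun i => (s i : ℂ)) := by
  have hin : ∀ i j, inner ℂ (WithLp.toLp 2 (N.col i) : EuclideanSpace ℂ n)
      (WithLp.toLp 2 (N.col j)) = if i = j then ((s i) ^ 2 : ℂ) else 0 := by
    intro i j
    have := congrFun (congrFun h i) j
    rw [diagonal_apply] at this
    rw [← this, mul_apply, PiLp.inner_apply]
    exact Finset.sum_congr rfl fun k _ => by simp [mul_comm]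
  set v : n → EuclideanSpace ℂ n := fun i => ((s i)⁻¹ : ℂ) • WithLp.toLp 2 (N.col i) with hv
  have hort : Orthonormal ℂ (({i | s i ≠ 0} : Set n).domRestrict v) := by
    rw [orthonormal_iff_ite]
    rintro ⟨i, hi⟩ ⟨j, hj⟩
    have hi' : (s i : ℂ) ≠ 0 := by exact_mod_cast hi
    simp only [Set.domRestrict_apply, hv, inner_smul_left, inner_smul_right, hin, Subtype.mk.injEq]
    split_ifs with hij
    · subst hij
      simp
      field_simp
    · simp
  -- Columns with `s i = 0` vanish, so any completion of the normalised nonzero columns to an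
  -- orthonormal basis will do.
  obtain ⟨b, hb⟩ := hort.exists_orthonormalBasis_extension_of_card_eq (by simp)
  refine ⟨(EuclideanSpace.basisFun n ℂ).toBasis.toMatrix b.toBasis,
    (EuclideanSpace.basisFun n ℂ).toMatrix_orthonormalBasis_mem_unitary b, ?_⟩
  ext k i
  rw [mul_diagonal]
  have hbk : (EuclideanSpace.basisFun n ℂ).toBasis.toMatrix b.toBasis k i = b i k := rfl
  rw [hbk]
  by_cases hi : s i = 0
  · have h0 := hin i i
    simp only [hi, if_true] at h0
    have h1 : (WithLp.toLp 2 (N.col i) : EuclideanSpace ℂ n) = 0 := by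
      rw [← inner_self_eq_zero (𝕜 := ℂ), h0]; simp
    have h2 := congrArg (fun w : EuclideanSpace ℂ n => w k) h1
    simp only [hi]
    simpa using h2
  · have hi' : (s i : ℂ) ≠ 0 := by exact_mod_cast hi
    rw [hb i hi]
    simp only [hv, PiLp.smul_apply, smul_eq_mul, Matrix.col_apply]
    field_simp

open Matrix in
/-- Singular value decomposition of a square complex matrix, with ordered singular values. -/
theorem Matrix.exists_singular_value_decomposition {m : ℕ} (M : Matrix (Fin m) (Fin m) ℂ) :
    ∃ A ∈ unitaryGroup (Fin m) ℂ, ∃ V ∈ unitaryGroup (Fin m) ℂ, ∃ s : Fin m → ℝ,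
      Antitone s ∧ (∀ i, 0 ≤ s i) ∧ M = A * diagonal (fun i => (s i : ℂ)) * star V := by
  have hH : (star M * M).PosSemidef := posSemidef_conjTranspose_mul_self M
  obtain ⟨V, hV, hMV⟩ := hH.isHermitian.exists_unitary_conj_diagonal (finCongr (by simp))
  set l : Fin m → ℝ := fun i => hH.isHermitian.eigenvalues₀ ((finCongr (by simp)).symm i) with hl
  have hl0 : ∀ i, 0 ≤ l i := by
    intro i
    have := hH.eigenvalues_nonneg
      ((Fintype.equivOfCardEq (Fintype.card_fin _)) (Fin.cast (by simp) i))
    simpa [IsHermitian.eigenvalues, hl] using this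
  have hanti : Antitone l := fun i j hij =>
    hH.isHermitian.eigenvalues₀_antitone (Fin.le_def.2 (Fin.le_def.1 hij))
  have hVV := mem_unitaryGroup_iff'.1 hV
  -- Eigenvectors of `M† M` make the columns of `M V` orthogonal with squared lengths `l`.
  obtain ⟨A, hA, hN⟩ := exists_unitary_mul_diagonal_of_orthogonal_columns
    (N := M * V) (s := fun i => √(l i)) (by
      rw [star_mul, mul_assoc, ← mul_assoc (star M), hMV]
      simp only [mul_assoc, hVV, mul_one]
      rw [← mul_assoc, hVV, one_mul]
      congr 1
      ext i
      rw [← Complex.ofReal_pow, Real.sq_sqrt (hl0 i)])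
  refine ⟨A, hA, V, hV, fun i => √(l i), fun i j hij => Real.sqrt_le_sqrt (hanti hij),
    fun i => Real.sqrt_nonneg _, ?_⟩
  rw [← hN, mul_assoc, mem_unitaryGroup_iff.1 hV, mul_one]

open Matrix in
/-- For a unitary `T`, the diagonal of `T† diag(l) T` pairs with `w` at least as much as some
rearrangement of `l` does. -/
theorem Matrix.le_sum_mul_of_forall_perm {n : Type*} [Fintype n] [DecidableEq n]
    {w l : n → ℝ} {m : ℝ} (hm : ∀ σ : Equiv.Perm n, m ≤ ∑ p, w p * l (σ p))
    {T : Matrix n n ℂ} (hT : T ∈ unitaryGroup n ℂ) :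
    m ≤ ∑ p, w p * ((star T * diagonal (fun i => (l i : ℂ)) * T) p p).re := by
  -- The diagonal in question is `D l` with `D` doubly stochastic. By Birkhoff it is an average of
  -- rearrangements of `l`, each controlled by `hm`.
  set D : Matrix n n ℝ := Matrix.of fun p q => Complex.normSq (T q p) with hD
  have hdiag : ∀ p, ((star T * diagonal (fun i => (l i : ℂ)) * T) p p).re = ∑ q, D p q * l q := by
    intro p
    rw [mul_apply, Complex.re_sum]
    refine Finset.sum_congr rfl fun q _ => ?_
    rw [mul_diagonal]
    simp [hD, Complex.normSq_apply]
    ring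
  have hDS : D ∈ doublyStochastic ℝ n := by
    rw [mem_doublyStochastic_iff_sum]
    refine ⟨fun i j => Complex.normSq_nonneg _, fun i => ?_, fun j => ?_⟩
    · have := congrFun (congrFun (mem_unitaryGroup_iff'.1 hT) i) i
      rw [mul_apply, one_apply_eq] at this
      have := congrArg Complex.re this
      rw [Complex.re_sum, Complex.one_re] at this
      rw [← this]
      refine Finset.sum_congr rfl fun q _ => ?_
      simp [hD, Complex.normSq_apply]
    · have := congrFun (congrFun (mem_unitaryGroup_iff.1 hT) j) j
      rw [mul_apply, one_apply_eq] at this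
      have := congrArg Complex.re this
      rw [Complex.re_sum, Complex.one_re] at this
      rw [← this]
      refine Finset.sum_congr rfl fun q _ => ?_
      simp [hD, Complex.normSq_apply]
  obtain ⟨c, hc0, hc1, hc⟩ := exists_eq_sum_perm_of_mem_doublyStochastic hDS
  have hrow : ∀ p, ∑ q, D p q * l q = ∑ σ, c σ * l (σ p) := by
    intro p
    simp_rw [← hc, Matrix.sum_apply, Finset.sum_mul]
    rw [Finset.sum_comm]
    refine Finset.sum_congr rfl fun σ _ => ?_
    simp [PEquiv.toMatrix_apply, Equiv.toPEquiv_apply, ite_mul]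
  calc m = ∑ σ, c σ * m := by rw [← Finset.sum_mul, hc1, one_mul]
    _ ≤ ∑ σ, c σ * ∑ p, w p * l (σ p) :=
        Finset.sum_le_sum fun σ _ => mul_le_mul_of_nonneg_left (hm σ) (hc0 σ)
    _ = _ := by
        simp_rw [hdiag, hrow, Finset.mul_sum]
        rw [Finset.sum_comm]
        exact Finset.sum_congr rfl fun p _ => Finset.sum_congr rfl fun σ _ => by ring

/-! ### Partial transposition and Schmidt coefficients -/

open Matrix Kronecker in
/-- The partial transpose intertwines the local change of basis `a ⊗ b` with `a ⊗ conj b`. -/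
theorem partialTranspose_kronecker_conj {m n : ℕ} (a : Matrix (Fin m) (Fin m) ℂ)
    (b : Matrix (Fin n) (Fin n) ℂ) (A : Matrix (Fin m × Fin n) (Fin m × Fin n) ℂ) :
    partialTranspose (star (a ⊗ₖ b) * A * (a ⊗ₖ b)) =
      star (a ⊗ₖ (b.map star)) * partialTranspose A * (a ⊗ₖ (b.map star)) := by
  ext ⟨i, j⟩ ⟨k, l⟩
  simp only [partialTranspose, of_apply, mul_apply, Fintype.sum_prod_type, Finset.sum_mul,
    kroneckerMap_apply, star_apply, map_apply, star_mul', star_star]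
  refine Finset.sum_congr rfl fun q₁ _ => ?_
  rw [Finset.sum_comm]
  conv_rhs => rw [Finset.sum_comm]
  refine Finset.sum_congr rfl fun p₁ _ => ?_
  rw [Finset.sum_comm]
  exact Finset.sum_congr rfl fun p₂ _ => Finset.sum_congr rfl fun q₂ _ => by ring

/-- The vector of `ℂ^n ⊗ ℂ^n` with Schmidt coefficients `s` along the standard basis. -/
def schmidtVector {n : ℕ} (s : Fin n → ℝ) : Fin n × Fin n → ℂ :=
  fun p => if p.1 = p.2 then (s p.1 : ℂ) else 0

open Matrix in
theorem schmidtVector_quadForm {n : ℕ} (s : Fin n → ℝ)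
    (A : Matrix (Fin n × Fin n) (Fin n × Fin n) ℂ) :
    star (schmidtVector s) ⬝ᵥ (partialTranspose A *ᵥ schmidtVector s) =
      ∑ i, ∑ j, (s i * s j : ℂ) * A (i, j) (j, i) := by
  simp only [dotProduct, mulVec, schmidtVector, partialTranspose, of_apply, Fintype.sum_prod_type,
    Pi.star_apply, mul_ite, mul_zero, Finset.sum_ite_eq, Finset.mem_univ, if_true,
    apply_ite (star : ℂ → ℂ), star_zero, ite_mul, zero_mul]
  simp only [Complex.star_def, Complex.conj_ofReal, Finset.mul_sum]
  exact Finset.sum_congr rfl fun i _ => Finset.sum_congr rfl fun j _ => by ring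

/-- The eigenvalues of the partial transpose of the projection on `schmidtVector s`. -/
def schmidtWeight (s : Fin 3 → ℝ) (p : Fin 3 × Fin 3) : ℝ :=
  if p.1 ≤ p.2 then s p.1 * s p.2 else -(s p.1 * s p.2)

/-- The eigenvectors of the partial transpose of the projection on `schmidtVector s`. -/
noncomputable def schmidtEigenbasis : Matrix (Fin 3 × Fin 3) (Fin 3 × Fin 3) ℂ :=
  Matrix.of fun p q =>
    if q.1 = q.2 then (if p = q then 1 else 0)
    else if q.1 < q.2 then (if p = q ∨ p = q.swap then ((√2)⁻¹ : ℝ) else 0)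
    else (if p = q then ((√2)⁻¹ : ℝ) else if p = q.swap then (-(√2)⁻¹ : ℝ) else 0)

theorem sqrt_two_inv_mul_self : (((√2)⁻¹ : ℝ) : ℂ) * (((√2)⁻¹ : ℝ) : ℂ) = 1 / 2 := by
  rw [← Complex.ofReal_mul, ← mul_inv, Real.mul_self_sqrt (by norm_num)]
  norm_num

open Matrix in
theorem schmidtEigenbasis_mem_unitaryGroup :
    schmidtEigenbasis ∈ unitaryGroup (Fin 3 × Fin 3) ℂ := by
  have h := sqrt_two_inv_mul_self
  rw [mem_unitaryGroup_iff']
  ext ⟨i, j⟩ ⟨k, l⟩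
  simp only [mul_apply, Fintype.sum_prod_type, star_apply, Fin.sum_univ_three]
  generalize hr : (√2)⁻¹ = r at h
  fin_cases i <;> fin_cases j <;> fin_cases k <;> fin_cases l <;>
    simp [schmidtEigenbasis, hr] <;> linear_combination 2 * h

-- The right-hand side is the partial transpose of the rank-one matrix of `schmidtVector s`. It
-- exchanges `e_i ⊗ e_j` and `e_j ⊗ e_i` up to the factor `s i * s j`, so symmetric and
-- antisymmetric combinations diagonalise it.
open Matrix in
theorem schmidtEigenbasis_conj_diagonal (s : Fin 3 → ℝ) :
    schmidtEigenbasis * diagonal (fun p => (schmidtWeight s p : ℂ)) * star schmidtEigenbasis =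
      Matrix.of fun p q => if p = q.swap then (s p.1 * s p.2 : ℂ) else 0 := by
  have h := sqrt_two_inv_mul_self
  ext ⟨i, j⟩ ⟨k, l⟩
  rw [Matrix.mul_apply]
  simp only [mul_diagonal, Fintype.sum_prod_type, star_apply, Fin.sum_univ_three]
  generalize hr : (√2)⁻¹ = r at h
  fin_cases i <;> fin_cases j <;> fin_cases k <;> fin_cases l <;>
    simp [schmidtEigenbasis, schmidtWeight, hr] <;>
    first
    | ring1
    | linear_combination (2 * s 0 * s 1) * h
    | linear_combination (2 * s 0 * s 2) * h
    | linear_combination (2 * s 1 * s 2) * h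

open Matrix in
theorem sum_schmidtWeight_mul (s : Fin 3 → ℝ) (B : Matrix (Fin 3 × Fin 3) (Fin 3 × Fin 3) ℂ) :
    ∑ i, ∑ j, (s i * s j : ℂ) * B (i, j) (j, i) =
      ∑ p, (schmidtWeight s p : ℂ) * (star schmidtEigenbasis * B * schmidtEigenbasis) p p := by
  have h1 : ∑ i, ∑ j, (s i * s j : ℂ) * B (i, j) (j, i) =
      trace (B * Matrix.of fun p q => if p = q.swap then (s p.1 * s p.2 : ℂ) else 0) := by
    rw [← Fintype.sum_prod_type' (f := fun i j => (s i * s j : ℂ) * B (i, j) (j, i))]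
    simp only [trace, diag_apply, mul_apply, of_apply, mul_ite, mul_zero, Finset.sum_ite_eq',
      Finset.mem_univ, if_true, Prod.fst_swap, Prod.snd_swap]
    refine Finset.sum_congr rfl fun p _ => ?_
    rw [mul_comm (B _ _), mul_comm (s p.1 : ℂ)]
    rfl
  rw [h1, ← schmidtEigenbasis_conj_diagonal, ← mul_assoc, ← mul_assoc, trace_mul_comm, ← mul_assoc,
    ← mul_assoc, trace]
  refine Finset.sum_congr rfl fun p _ => ?_
  rw [diag_apply, mul_diagonal, mul_comm]

open Matrix in
theorem schmidtVector_quadForm_re (s : Fin 3 → ℝ)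
    (A : Matrix (Fin 3 × Fin 3) (Fin 3 × Fin 3) ℂ) :
    (star (schmidtVector s) ⬝ᵥ (partialTranspose A *ᵥ schmidtVector s)).re =
      ∑ p, schmidtWeight s p * ((star schmidtEigenbasis * A * schmidtEigenbasis) p p).re := by
  rw [schmidtVector_quadForm, sum_schmidtWeight_mul, Complex.re_sum]
  exact Finset.sum_congr rfl fun p _ => by rw [Complex.re_ofReal_mul]

open Matrix in
/-- Absolutely PPT states have nonnegative overlap with every matrix whose spectrum is that of the
partial transpose of a pure state. -/
theorem sum_schmidtWeight_nonneg_of_mem_absolutelyPPT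
    {α U : Matrix (Fin 3 × Fin 3) (Fin 3 × Fin 3) ℂ} (hα : α ∈ absolutelyPPT 3 3)
    (hU : U ∈ unitaryGroup (Fin 3 × Fin 3) ℂ) (s : Fin 3 → ℝ) :
    0 ≤ ∑ p, schmidtWeight s p * ((star U * α * U) p p).re := by
  have hQ := schmidtEigenbasis_mem_unitaryGroup
  -- With `Q` the eigenbasis, conjugating by `Q U†` makes `Q` cancel and leaves the diagonal of `U†
  -- α U`.
  have h := (hα.2 _ (mul_mem hQ (Unitary.star_mem hU))).2.re_dotProduct_nonneg (schmidtVector s)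
  have h' := schmidtVector_quadForm_re s
    (schmidtEigenbasis * star U * α * star (schmidtEigenbasis * star U))
  have e : star schmidtEigenbasis *
      (schmidtEigenbasis * star U * α * star (schmidtEigenbasis * star U)) * schmidtEigenbasis =
      star U * α * U := by
    have h1 := mem_unitaryGroup_iff'.1 hQ
    simp only [star_mul, star_star, mul_assoc, h1, mul_one]
    rw [← mul_assoc, h1, one_mul]
  rw [e] at h'
  rw [← h']
  exact h

open Matrix in
theorem Matrix.PosSemidef.unitary_conj {n : Type*} [Fintype n] {A : Matrix n n ℂ}
    (hA : A.PosSemidef) (U : Matrix n n ℂ) : (U * A * star U).PosSemidef :=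
  hA.mul_mul_conjTranspose_same U

open Matrix in
theorem IsState.unitary_conj {m n : ℕ} {ρ U : Matrix (Fin m × Fin n) (Fin m × Fin n) ℂ}
    (hρ : IsState ρ) (hU : U ∈ unitaryGroup (Fin m × Fin n) ℂ) : IsState (U * ρ * star U) := by
  refine ⟨hρ.1.unitary_conj U, ?_⟩
  rw [trace_mul_comm, ← mul_assoc, mem_unitaryGroup_iff'.1 hU, one_mul, hρ.2]

theorem partialTranspose_isHermitian {m n : ℕ} {ρ : Matrix (Fin m × Fin n) (Fin m × Fin n) ℂ}
    (h : ρ.IsHermitian) : (partialTranspose ρ).IsHermitian := by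
  ext p q
  exact h.apply _ _

open Matrix Kronecker in
/-- A matrix has positive semidefinite partial transpose as soon as the quadratic forms given by
ordered Schmidt coefficients are nonnegative in every product basis. -/
theorem partialTranspose_posSemidef_of {A : Matrix (Fin 3 × Fin 3) (Fin 3 × Fin 3) ℂ}
    (hA : A.IsHermitian)
    (h : ∀ U ∈ unitaryGroup (Fin 3 × Fin 3) ℂ, ∀ s : Fin 3 → ℝ, Antitone s → (∀ i, 0 ≤ s i) →
      0 ≤ ∑ p, schmidtWeight s p * ((star U * A * U) p p).re) :
    (partialTranspose A).PosSemidef := by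
  refine PosSemidef.of_dotProduct_mulVec_nonneg (partialTranspose_isHermitian hA) fun ψ => ?_
  -- Singular values of the coefficient matrix are Schmidt coefficients. The local unitaries pass
  -- through the partial transpose and are absorbed into `U`.
  obtain ⟨a, ha, b, hb, s, hs, hs0, hM⟩ :=
    exists_singular_value_decomposition (Matrix.of fun i j => ψ (i, j))
  have hψ : ψ = (a ⊗ₖ (b.map star)) *ᵥ schmidtVector s := by
    ext ⟨i, j⟩
    have := congrFun (congrFun hM i) j
    rw [of_apply] at this
    rw [this, mul_apply]
    simp only [mul_diagonal, star_apply, mulVec, dotProduct, schmidtVector, kroneckerMap_apply,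
      map_apply, Fintype.sum_prod_type, mul_ite, mul_zero, Finset.sum_ite_eq, Finset.mem_univ,
      if_true]
    exact Finset.sum_congr rfl fun k _ => by ring
  have hab : a ⊗ₖ b ∈ unitaryGroup (Fin 3 × Fin 3) ℂ := kronecker_mem_unitary ha hb
  have hre : 0 ≤ (star ψ ⬝ᵥ (partialTranspose A *ᵥ ψ)).re := by
    have e : star ψ ⬝ᵥ (partialTranspose A *ᵥ ψ) = star (schmidtVector s) ⬝ᵥ
        (partialTranspose (star (a ⊗ₖ b) * A * (a ⊗ₖ b)) *ᵥ schmidtVector s) := by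
      rw [partialTranspose_kronecker_conj, hψ, star_mulVec, ← dotProduct_mulVec, mulVec_mulVec,
        mulVec_mulVec, star_eq_conjTranspose, mul_assoc]
    rw [e, schmidtVector_quadForm_re]
    have := h _ (mul_mem hab schmidtEigenbasis_mem_unitaryGroup) s hs hs0
    simpa only [star_mul, mul_assoc] using this
  have him : (star ψ ⬝ᵥ (partialTranspose A *ᵥ ψ)).im = 0 :=
    (partialTranspose_isHermitian hA).im_star_dotProduct_mulVec_self ψ
  exact Complex.nonneg_iff.2 ⟨hre, him.symm⟩

open Matrix in
theorem mem_absolutelyPPT_of {α : Matrix (Fin 3 × Fin 3) (Fin 3 × Fin 3) ℂ} (hα : IsState α)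
    (h : ∀ U ∈ unitaryGroup (Fin 3 × Fin 3) ℂ, ∀ s : Fin 3 → ℝ, Antitone s → (∀ i, 0 ≤ s i) →
      0 ≤ ∑ p, schmidtWeight s p * ((star U * α * U) p p).re) :
    α ∈ absolutelyPPT 3 3 := by
  refine ⟨⟨hα, partialTranspose_posSemidef_of hα.1.isHermitian h⟩, fun U hU =>
    ⟨hα.unitary_conj hU, partialTranspose_posSemidef_of
      (hα.unitary_conj hU).1.isHermitian fun V hV s hs hs0 => ?_⟩⟩
  have := h _ (mul_mem (Unitary.star_mem hU) hV) s hs hs0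
  simpa only [star_mul, star_star, mul_assoc] using this

open Matrix in
theorem unitary_conj_mem_absolutelyPPT {m n : ℕ}
    {α V : Matrix (Fin m × Fin n) (Fin m × Fin n) ℂ} (hα : α ∈ absolutelyPPT m n)
    (hV : V ∈ unitaryGroup (Fin m × Fin n) ℂ) : V * α * star V ∈ absolutelyPPT m n := by
  refine ⟨hα.2 V hV, fun U hU => ?_⟩
  have := hα.2 _ (mul_mem hU hV)
  simpa only [star_mul, mul_assoc] using this

/-! ### The two orderings of the weights -/

/-- An enumeration of the pairs of indices for which `schmidtWeight s` is nondecreasing whenever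
`s` is nonnegative and nonincreasing with `s 0 * s 2 ≤ s 1 ^ 2`. -/
def pairEquiv : Fin 9 ≃ Fin 3 × Fin 3 where
  toFun := ![(1, 0), (2, 0), (2, 1), (2, 2), (1, 2), (0, 2), (1, 1), (0, 1), (0, 0)]
  invFun p := !![8, 7, 5; 0, 6, 4; 1, 2, 3] p.1 p.2
  left_inv := by decide
  right_inv := by decide

/-- The entries of `schmidtWeight s`, enumerated by `pairEquiv`. -/
def schmidtWeightVector (s : Fin 3 → ℝ) : Fin 9 → ℝ :=
  ![-(s 0 * s 1), -(s 0 * s 2), -(s 1 * s 2), s 2 ^ 2, s 1 * s 2, s 0 * s 2, s 1 ^ 2, s 0 * s 1,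
    s 0 ^ 2]

theorem schmidtWeight_pairEquiv (s : Fin 3 → ℝ) (k : Fin 9) :
    schmidtWeight s (pairEquiv k) = schmidtWeightVector s k := by
  fin_cases k <;> simp [schmidtWeight, pairEquiv, schmidtWeightVector] <;> ring

/-- Half the quadratic form of `L1 d`. -/
def schmidtForm (d : Fin 9 → ℝ) (s : Fin 3 → ℝ) : ℝ :=
  ∑ k, schmidtWeightVector s k * d k

theorem schmidtForm_eq (d : Fin 9 → ℝ) (s : Fin 3 → ℝ) :
    schmidtForm d s = d 8 * s 0 ^ 2 + d 6 * s 1 ^ 2 + d 3 * s 2 ^ 2 + (d 7 - d 0) * (s 0 * s 1) +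
      (d 5 - d 1) * (s 0 * s 2) + (d 4 - d 2) * (s 1 * s 2) := by
  simp only [schmidtForm, Fin.sum_univ_succ, schmidtWeightVector]
  simp
  ring

theorem sum_schmidtWeight_eq (s : Fin 3 → ℝ) (f : Fin 3 × Fin 3 → ℝ) :
    ∑ p, schmidtWeight s p * f p = schmidtForm (fun k => f (pairEquiv k)) s := by
  rw [← pairEquiv.sum_comp, schmidtForm]
  simp_rw [schmidtWeight_pairEquiv]

theorem monotone_of_le_succ_fin_nine {f : Fin 9 → ℝ} (h0 : f 0 ≤ f 1) (h1 : f 1 ≤ f 2)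
    (h2 : f 2 ≤ f 3) (h3 : f 3 ≤ f 4) (h4 : f 4 ≤ f 5) (h5 : f 5 ≤ f 6) (h6 : f 6 ≤ f 7)
    (h7 : f 7 ≤ f 8) : Monotone f :=
  Fin.monotone_iff_le_succ.2 fun i => by fin_cases i <;> assumption

/-- By the rearrangement inequality the pairing is least when weights and spectrum are oppositely
ordered. Only the comparison of `s 0 * s 2` with `s 1 ^ 2` is left open, and reversing it exchanges
positions 5 and 6. -/
theorem schmidtForm_nonneg_of_perm {x : Fin 9 → ℝ} (hx : Antitone x) {s : Fin 3 → ℝ}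
    (hs : Antitone s) (hs0 : ∀ i, 0 ≤ s i)
    (h1 : s 0 * s 2 ≤ s 1 ^ 2 → 0 ≤ schmidtForm x s)
    (h2 : s 1 ^ 2 ≤ s 0 * s 2 → 0 ≤ schmidtForm (x ∘ Equiv.swap 5 6) s)
    (σ : Equiv.Perm (Fin 9)) : 0 ≤ schmidtForm (x ∘ σ) s := by
  have h01 : s 1 ≤ s 0 := hs (by decide)
  have h12 : s 2 ≤ s 1 := hs (by decide)
  have p0 := hs0 0
  have p1 := hs0 1
  have p2 := hs0 2
  have a1 : s 0 * s 2 ≤ s 0 * s 1 := by gcongr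
  have a2 : s 1 * s 2 ≤ s 0 * s 2 := by gcongr
  have a3 : s 2 ^ 2 ≤ s 1 * s 2 := by rw [sq]; gcongr
  have a4 : s 1 ^ 2 ≤ s 0 * s 1 := by rw [sq]; gcongr
  have a5 : s 0 * s 1 ≤ s 0 ^ 2 := by rw [sq]; gcongr
  have a6 : s 1 * s 2 ≤ s 1 ^ 2 := by rw [sq]; gcongr
  have a7 : 0 ≤ s 1 * s 2 := by positivity
  have a8 : 0 ≤ s 2 ^ 2 := by positivity
  rcases le_total (s 0 * s 2) (s 1 ^ 2) with h | h
  · have hm : Monotone (schmidtWeightVector s) := by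
      apply monotone_of_le_succ_fin_nine <;> simp [schmidtWeightVector] <;> linarith
    exact (h1 h).trans (hm.antivary hx).sum_mul_le_sum_mul_comp_perm
  · have hm : Monotone (schmidtWeightVector s ∘ Equiv.swap 5 6) := by
      have e5 : (Equiv.swap (5 : Fin 9) 6) 5 = 6 := by decide
      have e6 : (Equiv.swap (5 : Fin 9) 6) 6 = 5 := by decide
      have e (k : Fin 9) (hk : k ≠ 5) (hk' : k ≠ 6) : (Equiv.swap (5 : Fin 9) 6) k = k :=
        Equiv.swap_apply_of_ne_of_ne hk hk'
      apply monotone_of_le_succ_fin_nine <;>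
        simp [schmidtWeightVector, e5, e6, e] <;> linarith
    refine (h2 h).trans ?_
    have e1 : schmidtForm (x ∘ Equiv.swap 5 6) s =
        ∑ k, (schmidtWeightVector s ∘ Equiv.swap 5 6) k * x k := by
      rw [schmidtForm, ← Equiv.sum_comp (Equiv.swap (5 : Fin 9) 6)]
      simp
    have e2 : schmidtForm (x ∘ σ) s = ∑ k, (schmidtWeightVector s ∘ Equiv.swap 5 6) k *
        x (((Equiv.swap 5 6).trans σ) k) := by
      rw [schmidtForm, ← Equiv.sum_comp (Equiv.swap (5 : Fin 9) 6)]
      simp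
    rw [e1, e2]
    exact (hm.antivary hx).sum_mul_le_sum_mul_comp_perm

open Matrix in
/-- States with ordered spectrum `x` are absolutely PPT as soon as the two orderings of the
weights give nonnegative quadratic forms on their domains. -/
theorem conj_diagonal_mem_absolutelyPPT {x : Fin 9 → ℝ} (hx : Antitone x) (hx0 : ∀ k, 0 ≤ x k)
    (hx1 : ∑ k, x k = 1)
    (h : ∀ s : Fin 3 → ℝ, Antitone s → (∀ i, 0 ≤ s i) →
      (s 0 * s 2 ≤ s 1 ^ 2 → 0 ≤ schmidtForm x s) ∧
      (s 1 ^ 2 ≤ s 0 * s 2 → 0 ≤ schmidtForm (x ∘ Equiv.swap 5 6) s))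
    {V : Matrix (Fin 3 × Fin 3) (Fin 3 × Fin 3) ℂ} (hV : V ∈ unitaryGroup (Fin 3 × Fin 3) ℂ) :
    V * diagonal (fun p => (x (pairEquiv.symm p) : ℂ)) * star V ∈ absolutelyPPT 3 3 := by
  have hst : IsState (diagonal (fun p => (x (pairEquiv.symm p) : ℂ)) :
      Matrix (Fin 3 × Fin 3) (Fin 3 × Fin 3) ℂ) := by
    refine ⟨PosSemidef.diagonal fun p => by simpa using hx0 _, ?_⟩
    rw [trace_diagonal, ← Complex.ofReal_sum, pairEquiv.symm.sum_comp x, hx1, Complex.ofReal_one]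
  refine mem_absolutelyPPT_of (hst.unitary_conj hV) fun U hU s hs hs0 => ?_
  have e : star U * (V * diagonal (fun p => (x (pairEquiv.symm p) : ℂ)) * star V) * U =
      star (star V * U) * diagonal (fun p => ((x ∘ pairEquiv.symm) p : ℂ)) * (star V * U) := by
    simp only [star_mul, star_star, mul_assoc, Function.comp_apply]
  rw [e]
  refine le_sum_mul_of_forall_perm (fun σ => ?_) (mul_mem (Unitary.star_mem hV) hU)
  rw [sum_schmidtWeight_eq s fun p => (x ∘ pairEquiv.symm) (σ p)]
  exact schmidtForm_nonneg_of_perm hx hs hs0 (h s hs hs0).1 (h s hs hs0).2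
    ((pairEquiv.trans σ).trans pairEquiv.symm)

/-! ### Eigenvalue vectors and zeros at the boundary -/

open Matrix in
theorem exists_unitary_conj_eigenvalueVector {ρ : Matrix (Fin 3 × Fin 3) (Fin 3 × Fin 3) ℂ}
    (h : ρ.IsHermitian) (π : Equiv.Perm (Fin 9)) :
    ∃ V ∈ unitaryGroup (Fin 3 × Fin 3) ℂ, ρ =
      V * diagonal (fun p => (eigenvalueVector h (π (pairEquiv.symm p)) : ℂ)) * star V :=
  h.exists_unitary_conj_diagonal ((finCongr (by simp)).trans (π.symm.trans pairEquiv))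

theorem eigenvalueVector_antitone {ρ : Matrix (Fin 3 × Fin 3) (Fin 3 × Fin 3) ℂ}
    (h : ρ.IsHermitian) : Antitone (eigenvalueVector h) := fun _ _ hij =>
  h.eigenvalues₀_antitone (Fin.le_def.2 (Fin.le_def.1 hij))

theorem exists_eigenvalues_eq_eigenvalueVector {ρ : Matrix (Fin 3 × Fin 3) (Fin 3 × Fin 3) ℂ}
    (h : ρ.IsHermitian) (k : Fin 9) : ∃ p, h.eigenvalues p = eigenvalueVector h k :=
  ⟨Fintype.equivOfCardEq (Fintype.card_fin _) (Fin.cast (by simp) k), by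
    simp [Matrix.IsHermitian.eigenvalues, eigenvalueVector]⟩

theorem eigenvalueVector_pos {ρ : Matrix (Fin 3 × Fin 3) (Fin 3 × Fin 3) ℂ}
    (h : ρ.PosSemidef) (hr : ρ.rank = 9) (k : Fin 9) : 0 < eigenvalueVector h.isHermitian k := by
  obtain ⟨p, hp⟩ := exists_eigenvalues_eq_eigenvalueVector h.isHermitian k
  rw [← hp]
  refine (h.eigenvalues_nonneg p).lt_of_ne' fun h0 => ?_
  have h1 := h.isHermitian.rank_eq_card_non_zero_eigs
  rw [hr] at h1
  have h2 : Fintype.card {i // h.isHermitian.eigenvalues i ≠ 0} < Fintype.card (Fin 3 × Fin 3) :=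
    Fintype.card_subtype_lt (x := p) (by simpa using h0)
  rw [← h1] at h2
  simp at h2

open Matrix in
theorem sum_eigenvalueVector {ρ : Matrix (Fin 3 × Fin 3) (Fin 3 × Fin 3) ℂ}
    (h : ρ.IsHermitian) (ht : ρ.trace = 1) : ∑ k, eigenvalueVector h k = 1 := by
  obtain ⟨V, hV, hρ⟩ := exists_unitary_conj_eigenvalueVector h 1
  rw [hρ, trace_mul_comm, ← mul_assoc, mem_unitaryGroup_iff'.1 hV, one_mul, trace_diagonal] at ht
  rw [← pairEquiv.symm.sum_comp]
  exact_mod_cast ht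

theorem schmidtForm_sub_div (d : Fin 9 → ℝ) (c r : ℝ) (s : Fin 3 → ℝ) :
    schmidtForm (fun k => (d k - c) / r) s =
      (schmidtForm d s - c * (s 0 ^ 2 + s 1 ^ 2 + s 2 ^ 2)) / r := by
  simp only [schmidtForm_eq]
  ring

theorem schmidtForm_smul (d : Fin 9 → ℝ) (r : ℝ) (s : Fin 3 → ℝ) :
    schmidtForm d (r • s) = r ^ 2 * schmidtForm d s := by
  simp only [schmidtForm_eq, Pi.smul_apply, smul_eq_mul]
  ring

theorem continuous_schmidtForm (d : Fin 9 → ℝ) : Continuous (schmidtForm d) := by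
  simp only [funext (schmidtForm_eq d)]
  fun_prop

/-- Ordered Schmidt coefficients of unit vectors. -/
def schmidtSimplex : Set (Fin 3 → ℝ) :=
  {s | Antitone s ∧ (∀ i, 0 ≤ s i) ∧ s 0 ^ 2 + s 1 ^ 2 + s 2 ^ 2 = 1}

theorem isCompact_schmidtSimplex : IsCompact schmidtSimplex := by
  refine Metric.isCompact_of_isClosed_isBounded ?_ ?_
  · have h1 : IsClosed {s : Fin 3 → ℝ | Antitone s} := by
      simp only [Antitone, Set.ofPred_forall]
      exact isClosed_iInter fun i => isClosed_iInter fun j => isClosed_iInter fun _ =>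
        isClosed_le (continuous_apply j) (continuous_apply i)
    have h2 : IsClosed {s : Fin 3 → ℝ | ∀ i, 0 ≤ s i} := by
      simp only [Set.ofPred_forall]
      exact isClosed_iInter fun i => isClosed_le continuous_const (continuous_apply i)
    have h3 : IsClosed {s : Fin 3 → ℝ | s 0 ^ 2 + s 1 ^ 2 + s 2 ^ 2 = 1} :=
      isClosed_eq (by fun_prop) continuous_const
    exact h1.inter (h2.inter h3)
  · refine (Metric.isBounded_closedBall (x := (0 : Fin 3 → ℝ)) (r := 1)).subset fun s hs => ?_
    rw [mem_closedBall_zero_iff, pi_norm_le_iff_of_nonneg zero_le_one]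
    intro i
    rw [Real.norm_eq_abs, abs_le_one_iff_mul_self_le_one]
    have := hs.2.2
    fin_cases i <;> simp <;> nlinarith [sq_nonneg (s 0), sq_nonneg (s 1), sq_nonneg (s 2)]

theorem schmidtSimplex_nonempty : schmidtSimplex.Nonempty := by
  refine ⟨![1, 0, 0], ?_, fun i => by fin_cases i <;> simp, by simp⟩
  exact Fin.antitone_iff_succ_le.2 fun i => by fin_cases i <;> simp

/-- A lower bound for a form on unit vectors gives one on all ordered Schmidt coefficients. -/
theorem le_schmidtForm_of_forall_schmidtSimplex {d : Fin 9 → ℝ} {m : ℝ}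
    (h : ∀ s ∈ schmidtSimplex, m ≤ schmidtForm d s) {s : Fin 3 → ℝ} (hs : Antitone s)
    (hs0 : ∀ i, 0 ≤ s i) : m * (s 0 ^ 2 + s 1 ^ 2 + s 2 ^ 2) ≤ schmidtForm d s := by
  set N := s 0 ^ 2 + s 1 ^ 2 + s 2 ^ 2 with hN
  have hN0 : 0 ≤ N := by positivity
  rcases hN0.eq_or_lt' with h0 | h0
  · have e0 : s 0 ^ 2 = 0 := by nlinarith [sq_nonneg (s 0), sq_nonneg (s 1), sq_nonneg (s 2)]
    have e1 : s 1 ^ 2 = 0 := by nlinarith [sq_nonneg (s 0), sq_nonneg (s 1), sq_nonneg (s 2)]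
    have e2 : s 2 ^ 2 = 0 := by nlinarith [sq_nonneg (s 0), sq_nonneg (s 1), sq_nonneg (s 2)]
    rw [sq_eq_zero_iff] at e0 e1 e2
    rw [schmidtForm_eq, h0, e0, e1, e2]
    simp
  · have hr : 0 ≤ (√N)⁻¹ := by positivity
    have hr2 : ((√N)⁻¹) ^ 2 = N⁻¹ := by rw [inv_pow, Real.sq_sqrt hN0]
    have := h ((√N)⁻¹ • s) ⟨fun i j hij => mul_le_mul_of_nonneg_left (hs hij) hr,
      fun i => mul_nonneg hr (hs0 i), by
        simp only [Pi.smul_apply, smul_eq_mul, mul_pow, hr2, ← mul_add]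
        rw [← hN, inv_mul_cancel₀ h0.ne']⟩
    rw [schmidtForm_smul, hr2, inv_mul_eq_div, le_div_iff₀ h0] at this
    exact this

open Matrix in
/-- At a boundary point of full rank one of the two quadratic forms vanishes at some ordered unit
vector of Schmidt coefficients. -/
theorem IsBoundaryPoint.exists_schmidtForm_nonpos
    {ρ : Matrix (Fin 3 × Fin 3) (Fin 3 × Fin 3) ℂ} (hρ : IsBoundaryPoint ρ) (hr : ρ.rank = 9) :
    ∃ s ∈ schmidtSimplex, ∃ π : Equiv.Perm (Fin 9), (π = 1 ∨ π = Equiv.swap 5 6) ∧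
      schmidtForm (eigenvalueVector hρ.isHermitian ∘ π) s ≤ 0 := by
  set x := eigenvalueVector hρ.isHermitian with hx
  have hanti : Antitone x := eigenvalueVector_antitone _
  have hpos : ∀ k, 0 < x k := eigenvalueVector_pos hρ.1.1.1.1 hr
  have hsum : ∑ k, x k = 1 := sum_eigenvalueVector _ hρ.1.1.1.2
  -- If the minimum of both forms over the compact set of unit vectors were positive, there would be
  -- room to move away from the maximally mixed state.
  obtain ⟨s₀, hs₀, hmin⟩ := isCompact_schmidtSimplex.exists_isMinOn schmidtSimplex_nonempty
    ((continuous_schmidtForm x).min (continuous_schmidtForm (x ∘ Equiv.swap 5 6))).continuousOn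
  set m := min (schmidtForm x s₀) (schmidtForm (x ∘ Equiv.swap 5 6) s₀) with hm
  have hm1 : ∀ s ∈ schmidtSimplex, m ≤ schmidtForm x s := fun s hs =>
    (hmin hs).trans (min_le_left _ _)
  have hm2 : ∀ s ∈ schmidtSimplex, m ≤ schmidtForm (x ∘ Equiv.swap 5 6) s := fun s hs =>
    (hmin hs).trans (min_le_right _ _)
  by_cases hm0 : m ≤ 0
  · rcases min_le_iff.1 hm0 with h | h
    · exact ⟨s₀, hs₀, 1, Or.inl rfl, h⟩
    · exact ⟨s₀, hs₀, _, Or.inr rfl, h⟩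
  push Not at hm0
  refine absurd ⟨hρ.1, ?_⟩ hρ.2
  -- The bounds keep `1 - ε` positive, the eigenvalues nonnegative, and the forms nonnegative: the
  -- weights sum to `|s|²`, so subtracting `ε / 9` from every entry lowers a form by `ε / 9 * |s|²`.
  set ε : ℝ := min (1 / 2) (min (9 * x 8) (9 * m)) with hε
  have hε0 : 0 < ε := lt_min (by norm_num) (lt_min (by linarith [hpos 8]) (by linarith))
  have hε1 : ε ≤ 1 / 2 := min_le_left _ _
  have hε2 : ε ≤ 9 * x 8 := (min_le_right _ _).trans (min_le_left _ _)
  have hε3 : ε ≤ 9 * m := (min_le_right _ _).trans (min_le_right _ _)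
  have hε' : 0 < 1 - ε := by linarith
  refine ⟨ε, hε0, by linarith, ?_⟩
  obtain ⟨V, hV, hVρ⟩ := exists_unitary_conj_eigenvalueVector hρ.isHermitian 1
  set y : Fin 9 → ℝ := fun k => (x k - ε / 9) / (1 - ε) with hy
  have hmem : V * diagonal (fun p => (y (pairEquiv.symm p) : ℂ)) * star V ∈ absolutelyPPT 3 3 := by
    refine conj_diagonal_mem_absolutelyPPT ?_ (fun k => ?_) ?_ (fun s hs hs0 => ?_) hV
    · intro i j hij
      simp only [hy]
      gcongr
      exact hanti hij
    · have h8 : x 8 ≤ x k := hanti (Fin.le_last k)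
      exact div_nonneg (by linarith) hε'.le
    · simp only [hy]
      rw [← Finset.sum_div, Finset.sum_sub_distrib, hsum]
      simp
      field_simp
    · have hN : 0 ≤ s 0 ^ 2 + s 1 ^ 2 + s 2 ^ 2 := by positivity
      have hc : ε / 9 * (s 0 ^ 2 + s 1 ^ 2 + s 2 ^ 2) ≤ m * (s 0 ^ 2 + s 1 ^ 2 + s 2 ^ 2) := by
        gcongr
        linarith
      refine ⟨fun _ => ?_, fun _ => ?_⟩
      · rw [hy, schmidtForm_sub_div]
        exact div_nonneg
          (by linarith [le_schmidtForm_of_forall_schmidtSimplex hm1 hs hs0]) hε'.le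
      · have e : y ∘ Equiv.swap 5 6 = fun k => ((x ∘ Equiv.swap 5 6) k - ε / 9) / (1 - ε) := rfl
        rw [e, schmidtForm_sub_div]
        exact div_nonneg
          (by linarith [le_schmidtForm_of_forall_schmidtSimplex hm2 hs hs0]) hε'.le
  convert hmem using 1
  have hd : diagonal (fun p => (y (pairEquiv.symm p) : ℂ)) =
      (1 / (1 - ε)) • (diagonal (fun p => (x (pairEquiv.symm p) : ℂ)) -
        (ε / ((3 : ℕ) * (3 : ℕ))) • (1 : Matrix (Fin 3 × Fin 3) (Fin 3 × Fin 3) ℂ)) := by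
    ext p q
    rcases eq_or_ne p q with rfl | hpq
    · simp [hy]
      ring
    · simp [hpq]
  rw [hd, mul_smul_comm, smul_mul_assoc, mul_sub, sub_mul, mul_smul_comm, smul_mul_assoc, mul_one,
    mem_unitaryGroup_iff.1 hV]
  congr 2

/-! ### First-order conditions at a zero -/

theorem eq_zero_of_forall_sq_mul_add_mul_nonneg {A B : ℝ} (h : ∀ u : ℝ, 0 ≤ u ^ 2 * A + u * B) :
    B = 0 := by
  by_contra hB
  have hA : 0 < |A| + 1 := by positivity
  -- This point is close enough to zero for the linear term to outweigh `u ^ 2 * A`, making the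
  -- value negative if `B ≠ 0`.
  have h1 := h (-B / (|A| + 1))
  have h2 : (-B / (|A| + 1)) ^ 2 * A + -B / (|A| + 1) * B =
      B ^ 2 * (A - (|A| + 1)) / (|A| + 1) ^ 2 := by
    field_simp
    ring
  rw [h2] at h1
  have hB2 : 0 < B ^ 2 := by positivity
  have h3 : B ^ 2 * (A - (|A| + 1)) < 0 := mul_neg_of_pos_of_neg hB2 (by linarith [le_abs_self A])
  exact absurd h1 (not_le.2 (div_neg_of_neg_of_pos h3 (by positivity)))

open Matrix in
theorem L1_mulVec_eq_zero_iff (d : Fin 9 → ℝ) (s : Fin 3 → ℝ) : L1 d *ᵥ s = 0 ↔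
    2 * d 8 * s 0 + (d 7 - d 0) * s 1 + (d 5 - d 1) * s 2 = 0 ∧
    (d 7 - d 0) * s 0 + 2 * d 6 * s 1 + (d 4 - d 2) * s 2 = 0 ∧
    (d 5 - d 1) * s 0 + (d 4 - d 2) * s 1 + 2 * d 3 * s 2 = 0 := by
  simp [L1, funext_iff, Fin.forall_fin_succ, dotProduct, Fin.sum_univ_three]

open Matrix in
/-- A zero of a nonnegative quadratic form is a zero of its gradient. -/
theorem L1_mulVec_eq_zero_of_schmidtForm {d : Fin 9 → ℝ} {s : Fin 3 → ℝ}
    (h : ∀ t, 0 ≤ schmidtForm d t) (hs : schmidtForm d s = 0) : L1 d *ᵥ s = 0 := by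
  have key : ∀ t : Fin 3 → ℝ, schmidtForm d (s + t) - schmidtForm d s - schmidtForm d t =
      (L1 d *ᵥ s) ⬝ᵥ t := by
    intro t
    simp only [schmidtForm_eq, Pi.add_apply, dotProduct, mulVec, L1, Fin.sum_univ_three]
    simp
    ring
  ext k
  refine eq_zero_of_forall_sq_mul_add_mul_nonneg (A := schmidtForm d (Pi.single k 1)) fun u => ?_
  have h1 := key (u • Pi.single k 1)
  rw [schmidtForm_smul, dotProduct_smul, dotProduct_single_one, smul_eq_mul, hs] at h1
  linarith [h (s + u • Pi.single k 1)]

theorem schmidtForm_add_smul_single_sub (d : Fin 9 → ℝ) (i j : Fin 9) (δ : ℝ) (s : Fin 3 → ℝ) :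
    schmidtForm (d + δ • (Pi.single i 1 - Pi.single j 1)) s =
      schmidtForm d s + δ * (schmidtWeightVector s i - schmidtWeightVector s j) := by
  simp only [schmidtForm, Pi.add_apply, Pi.smul_apply, Pi.sub_apply, smul_eq_mul, mul_add,
    Finset.sum_add_distrib, mul_sub, Finset.sum_sub_distrib, Pi.single_apply, mul_ite, mul_one,
    mul_zero, Finset.sum_ite_eq', Finset.mem_univ, if_true]
  ring

theorem L1_add_smul (d d' : Fin 9 → ℝ) (δ : ℝ) : L1 (d + δ • d') = L1 d + δ • L1 d' := by
  ext i j
  fin_cases i <;> fin_cases j <;> simp [L1] <;> ring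

/-- The partial derivatives of the weights, as the rows of a matrix. -/
def schmidtWeightGradient (s : Fin 3 → ℝ) : Fin 3 → Fin 9 → ℝ :=
  ![![-s 1, -s 2, 0, 0, 0, s 2, 0, s 1, 2 * s 0],
    ![-s 0, 0, -s 2, 0, s 2, 0, 2 * s 1, s 0, 0],
    ![0, -s 0, -s 1, 2 * s 2, s 1, s 0, 0, 0, 0]]

open Matrix in
theorem L1_mulVec_apply (d : Fin 9 → ℝ) (s : Fin 3 → ℝ) (m : Fin 3) :
    (L1 d *ᵥ s) m = ∑ k, schmidtWeightGradient s m k * d k := by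
  simp only [mulVec, dotProduct, Fin.sum_univ_succ, L1, schmidtWeightGradient]
  fin_cases m <;> simp <;> ring

/-- The gradients of the weights are pairwise distinct, except at multiples of `(1, 1, 0)`. -/
theorem eq_of_schmidtWeightGradient_eq {s : Fin 3 → ℝ} (h01 : s 1 ≤ s 0) (h12 : s 2 ≤ s 1)
    (h2 : 0 ≤ s 2) (h1 : 0 < s 1) (hne : ¬ (s 0 = s 1 ∧ s 2 = 0)) {i j : Fin 9}
    (h : ∀ m, schmidtWeightGradient s m i = schmidtWeightGradient s m j) : i = j := by
  have e0 := h 0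
  have e1 := h 1
  have e2 := h 2
  by_contra hij
  clear h
  -- The only possible coincidences are 1 with 2 and 4 with 5; both need `s 0 = s 1` and `s 2 = 0`.
  fin_cases i <;> fin_cases j <;>
    first
    | exact hij rfl
    | simp [schmidtWeightGradient] at e0 e1 e2 <;>
        first
        | linarith
        | exact hne ⟨by linarith, by linarith⟩

-- The vector is the difference of the gradients of weights `i` and `j`. Plane rotations shift
-- diagonals along `Pi.single i 1 - Pi.single j 1`, so this makes a nonzero shift destroy the kernel
-- equation.
open Matrix in
theorem L1_single_sub_single_mulVec_ne_zero {s : Fin 3 → ℝ} (h01 : s 1 ≤ s 0) (h12 : s 2 ≤ s 1)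
    (h2 : 0 ≤ s 2) (h1 : 0 < s 1) (hne : ¬ (s 0 = s 1 ∧ s 2 = 0)) {i j : Fin 9} (hij : i ≠ j) :
    L1 (Pi.single i 1 - Pi.single j 1) *ᵥ s ≠ 0 := by
  refine fun h => hij (eq_of_schmidtWeightGradient_eq h01 h12 h2 h1 hne fun m => ?_)
  have hm := congrFun h m
  rw [L1_mulVec_apply] at hm
  simp only [Pi.sub_apply, mul_sub, Finset.sum_sub_distrib, Pi.single_apply, mul_ite, mul_one,
    mul_zero, Finset.sum_ite_eq', Finset.mem_univ, if_true, Pi.zero_apply] at hm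
  linarith

/-! ### Plane rotations -/

section Rotation

variable {n : Type*} [Fintype n] [DecidableEq n]

/-- The columns of a rotation in the coordinate plane of `p` and `q`. -/
def planeRotationCol (p q : n) (c t z : ℂ) (k : n) : n → ℂ :=
  if k = p then Pi.single p c + Pi.single q (t * z)
  else if k = q then Pi.single p (-(t * star z)) + Pi.single q c
  else Pi.single k 1

/-- A rotation in the coordinate plane of `p` and `q`. -/
def planeRotation (p q : n) (c t z : ℂ) : Matrix n n ℂ :=
  Matrix.of fun r k => planeRotationCol p q c t z k r

open Matrix in
theorem star_planeRotation_mul_mul_apply (p q : n) (c t z : ℂ) (B : Matrix n n ℂ) (k l : n) :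
    (star (planeRotation p q c t z) * B * planeRotation p q c t z) k l =
      star (planeRotationCol p q c t z k) ⬝ᵥ (B *ᵥ planeRotationCol p q c t z l) := by
  rw [mul_assoc, mul_apply]
  rfl

open Matrix in
theorem star_single_add_dotProduct_mulVec (B : Matrix n n ℂ) (p q : n) (a b a' b' : ℂ) :
    star (Pi.single p a + Pi.single q b) ⬝ᵥ (B *ᵥ (Pi.single p a' + Pi.single q b')) =
      star a * B p p * a' + star a * B p q * b' + star b * B q p * a' + star b * B q q * b' := by
  simp [mulVec_add, add_dotProduct, dotProduct_add]
  ring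

open Matrix in
theorem planeRotation_mem_unitaryGroup {p q : n} (hpq : p ≠ q) {c t : ℝ} (hct : c ^ 2 + t ^ 2 = 1)
    {z : ℂ} (hz : star z * z = 1) : planeRotation p q c t z ∈ unitaryGroup n ℂ := by
  have hct' : (c : ℂ) ^ 2 + (t : ℂ) ^ 2 = 1 := by exact_mod_cast hct
  have hz' : (starRingEnd ℂ) z * z = 1 := hz
  rw [mem_unitaryGroup_iff']
  ext k l
  rw [← mul_one (star _), star_planeRotation_mul_mul_apply, one_apply]
  by_cases hkp : k = p
  · subst hkp
    by_cases hlp : l = k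
    · subst hlp
      simp only [planeRotationCol, if_true, star_single_add_dotProduct_mulVec]
      simp [hpq, hpq.symm]
      linear_combination hct' + (t : ℂ) ^ 2 * hz'
    · by_cases hlq : l = q
      · subst hlq
        simp only [planeRotationCol, if_true, if_neg hlp, star_single_add_dotProduct_mulVec]
        simp [hpq, hpq.symm]
        ring
      · simp [planeRotationCol, hlp, hlq, Ne.symm hlp, Ne.symm hlq, add_dotProduct]
  · by_cases hkq : k = q
    · subst hkq
      by_cases hlp : l = p
      · subst hlp
        simp only [planeRotationCol, if_true, if_neg hkp, star_single_add_dotProduct_mulVec]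
        simp [hpq, hpq.symm]
        ring
      · by_cases hlq : l = k
        · subst hlq
          simp only [planeRotationCol, if_true, if_neg hlp, star_single_add_dotProduct_mulVec]
          simp [hpq, hpq.symm]
          linear_combination hct' + (t : ℂ) ^ 2 * hz'
        · simp [planeRotationCol, hlp, hlq, hkp, Ne.symm hlp, Ne.symm hlq, add_dotProduct]
    · by_cases hlp : l = p
      · subst hlp
        simp [planeRotationCol, hkp, hkq, dotProduct_add]
      · by_cases hlq : l = q
        · subst hlq
          simp [planeRotationCol, hkp, hkq, hlp, dotProduct_add]
        · simp [planeRotationCol, hkp, hkq, hlp, hlq, one_apply]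

open Matrix in
/-- The effect of a plane rotation on the diagonal of a Hermitian matrix. -/
theorem star_planeRotation_mul_mul_diag_re {p q : n} (hpq : p ≠ q) {c t : ℝ}
    (hct : c ^ 2 + t ^ 2 = 1) {z : ℂ} (hz : star z * z = 1) {Y : Matrix n n ℂ}
    (hY : Y.IsHermitian) (k : n) :
    ((star (planeRotation p q c t z) * Y * planeRotation p q c t z) k k).re = (Y k k).re +
      (t ^ 2 * ((Y q q).re - (Y p p).re) + 2 * c * t * (z * Y p q).re) *
        ((if k = p then 1 else 0) - (if k = q then 1 else 0)) := by
  have hz2 : z.re ^ 2 + z.im ^ 2 = 1 := by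
    have := congrArg Complex.re hz
    simp at this
    linarith
  have hYqp : Y q p = star (Y p q) := (hY.apply q p).symm
  rw [star_planeRotation_mul_mul_apply]
  by_cases hkp : k = p
  · subst hkp
    simp only [planeRotationCol, if_true, star_single_add_dotProduct_mulVec, if_neg hpq, hYqp]
    simp
    have hq : (Y q q).im = 0 := by
      have := congrArg Complex.im (hY.apply q q)
      simp at this; linarith
    rw [hq]
    linear_combination (Y k k).re * hct + t ^ 2 * (Y q q).re * hz2
  · by_cases hkq : k = q
    · subst hkq
      simp only [planeRotationCol, if_true, star_single_add_dotProduct_mulVec, if_neg hkp, hYqp]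
      simp
      have hp : (Y p p).im = 0 := by
        have := congrArg Complex.im (hY.apply p p)
        simp at this; linarith
      rw [hp]
      linear_combination (Y k k).re * hct + t ^ 2 * (Y p p).re * hz2
    · simp [planeRotationCol, hkp, hkq]

end Rotation

/-! ### Rigidity of segments under rotations -/

/-- The diagonal of a matrix on `ℂ^3 ⊗ ℂ^3`, enumerated by `pairEquiv`. -/
def diagVector (Y : Matrix (Fin 3 × Fin 3) (Fin 3 × Fin 3) ℂ) (k : Fin 9) : ℝ :=
  (Y (pairEquiv k) (pairEquiv k)).re

/-- The change of the `i`-th diagonal entry under a rotation in the plane of `i` and `j`. -/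
def rotationShift (Y : Matrix (Fin 3 × Fin 3) (Fin 3 × Fin 3) ℂ) (i j : Fin 9) (c t : ℝ) (z : ℂ) :
    ℝ :=
  t ^ 2 * (diagVector Y j - diagVector Y i) +
    2 * c * t * (z * Y (pairEquiv i) (pairEquiv j)).re

/-- No ordering or sign of `s` is required; nonnegativity on all of ℝ³ is what turns a zero into a
critical point. -/
theorem schmidtForm_diagVector_nonneg {Y : Matrix (Fin 3 × Fin 3) (Fin 3 × Fin 3) ℂ}
    (hY : Y ∈ absolutelyPPT 3 3) (s : Fin 3 → ℝ) : 0 ≤ schmidtForm (diagVector Y) s := by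
  have h := sum_schmidtWeight_nonneg_of_mem_absolutelyPPT hY (one_mem _) s
  rw [sum_schmidtWeight_eq] at h
  simp only [star_one, one_mul, mul_one] at h
  exact h

theorem schmidtForm_rotation_nonneg {Y : Matrix (Fin 3 × Fin 3) (Fin 3 × Fin 3) ℂ}
    (hY : Y ∈ absolutelyPPT 3 3) {i j : Fin 9} (hij : i ≠ j) {c t : ℝ} (hct : c ^ 2 + t ^ 2 = 1)
    {z : ℂ} (hz : star z * z = 1) (s : Fin 3 → ℝ) :
    0 ≤ schmidtForm (diagVector Y + rotationShift Y i j c t z • (Pi.single i 1 - Pi.single j 1))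
      s := by
  have hij' : pairEquiv i ≠ pairEquiv j := pairEquiv.injective.ne hij
  have h := sum_schmidtWeight_nonneg_of_mem_absolutelyPPT hY
    (planeRotation_mem_unitaryGroup hij' hct hz) s
  rw [sum_schmidtWeight_eq] at h
  refine h.trans_eq (congrArg (fun d => schmidtForm d s) (funext fun k => ?_))
  rw [star_planeRotation_mul_mul_diag_re hij' hct hz hY.1.1.1.isHermitian]
  simp [diagVector, rotationShift, Pi.single_apply]

/-- Stationarity under rotations: off-diagonal entries between different weights vanish. -/
theorem apply_eq_zero_of_schmidtWeightVector_ne {Y : Matrix (Fin 3 × Fin 3) (Fin 3 × Fin 3) ℂ}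
    (hY : Y ∈ absolutelyPPT 3 3) {s : Fin 3 → ℝ} (hs : schmidtForm (diagVector Y) s = 0)
    {i j : Fin 9} (hw : schmidtWeightVector s i ≠ schmidtWeightVector s j) :
    Y (pairEquiv i) (pairEquiv j) = 0 := by
  have hij : i ≠ j := fun h => hw (by rw [h])
  have key : ∀ z : ℂ, star z * z = 1 → (z * Y (pairEquiv i) (pairEquiv j)).re = 0 := by
    intro z hz
    set W := schmidtWeightVector s i - schmidtWeightVector s j with hW
    have hW0 : W ≠ 0 := sub_ne_zero.2 hw
    -- Parametrising the rotation by its tangent `u` turns the form at `s` into a positive multiple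
    -- of a quadratic in `u` without constant term.
    have h0 := eq_zero_of_forall_sq_mul_add_mul_nonneg
      (A := (diagVector Y j - diagVector Y i) * W)
      (B := 2 * (z * Y (pairEquiv i) (pairEquiv j)).re * W) fun u => by
        have hu : 0 < 1 + u ^ 2 := by positivity
        have hr : ((√(1 + u ^ 2))⁻¹) ^ 2 = (1 + u ^ 2)⁻¹ := by rw [inv_pow, Real.sq_sqrt hu.le]
        set r := (√(1 + u ^ 2))⁻¹ with hr'
        have h := schmidtForm_rotation_nonneg hY hij (c := r) (t := u * r) (by
          rw [mul_pow, hr]; field_simp) hz s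
        rw [schmidtForm_add_smul_single_sub, hs, zero_add, rotationShift, ← hW] at h
        have e : ((u * r) ^ 2 * (diagVector Y j - diagVector Y i) +
            2 * r * (u * r) * (z * Y (pairEquiv i) (pairEquiv j)).re) * W =
            r ^ 2 * (u ^ 2 * ((diagVector Y j - diagVector Y i) * W) +
              u * (2 * (z * Y (pairEquiv i) (pairEquiv j)).re * W)) := by ring
        rw [e, hr] at h
        exact nonneg_of_mul_nonneg_right h (inv_pos.2 hu)
    rcases mul_eq_zero.1 h0 with h | h
    · linarith
    · exact absurd h hW0
  have h1 := key 1 (by simp)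
  have h2 := key Complex.I (by simp)
  apply Complex.ext
  · simpa using h1
  · simpa using h2

open Matrix in
/-- If a diagonal absolutely PPT state lies on the boundary at `s` and the gradients of the weights
at `s` are pairwise distinct, then the endpoints of a segment through it are diagonal, constant
where the state is, and satisfy the same linear equations. -/
theorem diagonal_of_convex_combination {x : Fin 9 → ℝ}
    {X Y Z : Matrix (Fin 3 × Fin 3) (Fin 3 × Fin 3) ℂ}
    (hXx : X = diagonal (fun p => (x (pairEquiv.symm p) : ℂ)))
    (hX : X ∈ absolutelyPPT 3 3) (hY : Y ∈ absolutelyPPT 3 3) (hZ : Z ∈ absolutelyPPT 3 3)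
    {a b : ℝ} (ha : 0 < a) (hb : 0 < b) (hXYZ : a • Y + b • Z = X) {s : Fin 3 → ℝ}
    (hs : schmidtForm x s = 0)
    (hgrad : ∀ i j : Fin 9, i ≠ j → L1 (Pi.single i 1 - Pi.single j 1) *ᵥ s ≠ 0) :
    L1 x *ᵥ s = 0 ∧ L1 (diagVector Y) *ᵥ s = 0 ∧
      (∀ i j, x i = x j → diagVector Y i = diagVector Y j) ∧
      ∀ i j, i ≠ j → Y (pairEquiv i) (pairEquiv j) = 0 := by
  have hentry : ∀ p q, (a : ℂ) * Y p q + b * Z p q = X p q := fun p q => by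
    rw [← hXYZ]; simp
  have hdX : diagVector X = x := by ext k; simp [diagVector, hXx]
  have hdYZ : ∀ k, a * diagVector Y k + b * diagVector Z k = x k := fun k => by
    have := congrArg Complex.re (hentry (pairEquiv k) (pairEquiv k))
    rw [← hdX]
    simpa [diagVector] using this
  have hx : ∀ t, 0 ≤ schmidtForm x t := fun t => by
    simpa only [hdX] using schmidtForm_diagVector_nonneg hX t
  have hform : ∀ (d d' e : Fin 9 → ℝ), (∀ k, a * d k + b * d' k = e k) →
      a * schmidtForm d s + b * schmidtForm d' s = schmidtForm e s := by
    intro d d' e h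
    simp only [schmidtForm, Finset.mul_sum, ← Finset.sum_add_distrib, ← h]
    exact Finset.sum_congr rfl fun k _ => by ring
  have hzero : ∀ {u v : ℝ}, 0 ≤ u → 0 ≤ v → a * u + b * v = 0 → u = 0 := by
    intro u v hu hv h
    have h1 := mul_nonneg hb.le hv
    have h2 : a * u = 0 := le_antisymm (by linarith) (mul_nonneg ha.le hu)
    exact (mul_eq_zero.1 h2).resolve_left ha.ne'
  have hYs : schmidtForm (diagVector Y) s = 0 :=
    hzero (schmidtForm_diagVector_nonneg hY s) (schmidtForm_diagVector_nonneg hZ s)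
      ((hform _ _ _ hdYZ).trans hs)
  have hLx : L1 x *ᵥ s = 0 := L1_mulVec_eq_zero_of_schmidtForm hx hs
  have hLY : L1 (diagVector Y) *ᵥ s = 0 :=
    L1_mulVec_eq_zero_of_schmidtForm (schmidtForm_diagVector_nonneg hY) hYs
  have hXrot : ∀ {i j : Fin 9}, i ≠ j → ∀ {c t : ℝ} {z : ℂ},
      rotationShift X i j c t z = t ^ 2 * (x j - x i) := by
    intro i j hij c t z
    have h0 : X (pairEquiv i) (pairEquiv j) = 0 := by simp [hXx, hij]
    rw [rotationShift, hdX, h0]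
    simp
  have hshift : ∀ (i j : Fin 9) (c t : ℝ) (z : ℂ),
      a * rotationShift Y i j c t z + b * rotationShift Z i j c t z = rotationShift X i j c t z := by
    intro i j c t z
    have h1 : a * (z * Y (pairEquiv i) (pairEquiv j)).re +
        b * (z * Z (pairEquiv i) (pairEquiv j)).re = (z * X (pairEquiv i) (pairEquiv j)).re := by
      rw [← hentry]
      simp
      ring
    have h2 := hdYZ i
    have h3 := hdYZ j
    simp only [rotationShift, hdX]
    linear_combination t ^ 2 * (h3 - h2) + 2 * c * t * h1
  have hcancel : ∀ {d : Fin 9 → ℝ} {i j : Fin 9} {δ : ℝ}, i ≠ j → L1 d *ᵥ s = 0 →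
      L1 (d + δ • (Pi.single i 1 - Pi.single j 1)) *ᵥ s = 0 → δ = 0 := by
    intro d i j δ hij h0 h1
    rw [L1_add_smul, add_mulVec, h0, zero_add, smul_mulVec] at h1
    exact (smul_eq_zero.1 h1).resolve_right (hgrad i j hij)
  -- When `x i = x j` the rotation does not change the diagonal of `X`, so the rotated diagonals of
  -- `Y` and `Z` still combine to `x` and their forms vanish at `s`. The kernel equation then holds
  -- before and after, and `hcancel` kills the shift.
  have hsame : ∀ {i j : Fin 9}, i ≠ j → x i = x j → ∀ {c t : ℝ}, c ^ 2 + t ^ 2 = 1 →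
      ∀ {z : ℂ}, star z * z = 1 → rotationShift Y i j c t z = 0 := by
    intro i j hij hxij c t hct z hz
    refine hcancel hij hLY (L1_mulVec_eq_zero_of_schmidtForm
      (schmidtForm_rotation_nonneg hY hij hct hz) ?_)
    refine hzero (schmidtForm_rotation_nonneg hY hij hct hz s)
      (schmidtForm_rotation_nonneg hZ hij hct hz s) ((hform _ _ x fun k => ?_).trans hs)
    have h1 := hshift i j c t z
    rw [hXrot hij, hxij, sub_self, mul_zero] at h1
    simp only [Pi.add_apply, Pi.smul_apply, smul_eq_mul]
    linear_combination hdYZ k +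
      (Pi.single (M := fun _ => ℝ) i 1 - Pi.single (M := fun _ => ℝ) j 1) k * h1
  refine ⟨hLx, hLY, fun i j hxij => ?_, fun i j hij => ?_⟩
  · rcases eq_or_ne i j with rfl | hij
    · rfl
    have := hsame hij hxij (c := 0) (t := 1) (by norm_num) (z := 1) (by simp)
    simp [rotationShift] at this
    linarith
  · by_cases hxij : x i = x j
    · have hr : (√2)⁻¹ ^ 2 + (√2)⁻¹ ^ 2 = (1 : ℝ) := by
        rw [inv_pow, Real.sq_sqrt (by norm_num)]; norm_num
      have hr0 : (√2)⁻¹ ≠ (0 : ℝ) := by positivity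
      have h0 := hsame hij hxij (c := 0) (t := 1) (by norm_num) (z := 1) (by simp)
      have hd : diagVector Y j - diagVector Y i = 0 := by simpa [rotationShift] using h0
      have h1 := hsame hij hxij hr (z := 1) (by simp)
      have h2 := hsame hij hxij hr (z := Complex.I) (by simp)
      apply Complex.ext
      · simpa [rotationShift, hd] using h1
      · simpa [rotationShift, hd] using h2
    · refine apply_eq_zero_of_schmidtWeightVector_ne hY hYs fun hw => hxij ?_
      have h1 : schmidtForm (x + (x j - x i) • (Pi.single i 1 - Pi.single j 1)) s = 0 := by
        rw [schmidtForm_add_smul_single_sub, hs, hw]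
        ring
      have h2 : ∀ t, 0 ≤ schmidtForm (x + (x j - x i) • (Pi.single i 1 - Pi.single j 1)) t := by
        intro t
        have := schmidtForm_rotation_nonneg hX hij (c := 0) (t := 1) (by norm_num) (z := 1)
          (by simp) t
        rwa [hXrot hij, hdX, one_pow, one_mul] at this
      have := hcancel hij hLx (L1_mulVec_eq_zero_of_schmidtForm h2 h1)
      linarith

/-! ### Three-step spectra -/

/-- The vectors with entries `a`, `b`, `c` that arise from a nonincreasing one with simple first
entry by possibly exchanging the entries `5` and `6`. -/
def IsThreeStep (x : Fin 9 → ℝ) (a b c : ℝ) : Prop :=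
  x = ![a, b, c, c, c, c, c, c, c] ∨ x = ![a, b, b, c, c, c, c, c, c] ∨
  x = ![a, b, b, b, c, c, c, c, c] ∨ x = ![a, b, b, b, b, c, c, c, c] ∨
  x = ![a, b, b, b, b, b, c, c, c] ∨ x = ![a, b, b, b, b, c, b, c, c] ∨
  x = ![a, b, b, b, b, b, b, c, c] ∨ x = ![a, b, b, b, b, b, b, b, c]

theorem eq_or_eq_of_ncard_range_eq_three {f : Fin 9 → ℝ} (hf : Antitone f) (h01 : f 1 < f 0)
    (h3 : (Set.range f).ncard = 3) : f 8 < f 1 ∧ ∀ k, k ≠ 0 → f k = f 1 ∨ f k = f 8 := by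
  have h81 : f 8 ≤ f 1 := hf (by decide)
  have hk1 : ∀ k, k ≠ 0 → f k ≤ f 1 := fun k hk => hf (Fin.one_le_of_ne_zero hk)
  have hk8 : ∀ k, f 8 ≤ f k := fun k => hf (Fin.le_last k)
  have hlt : f 8 < f 1 := by
    refine h81.lt_of_ne fun h => ?_
    have hsub : Set.range f ⊆ {f 0, f 1} := by
      rintro _ ⟨k, rfl⟩
      by_cases hk : k = 0
      · simp [hk]
      · right
        exact le_antisymm (hk1 k hk) (h ▸ hk8 k)
    have h2 := Set.ncard_le_ncard hsub (Set.toFinite _)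
    have h4 := Set.ncard_insert_le (f 0) {f 1}
    rw [Set.ncard_singleton] at h4
    omega
  refine ⟨hlt, fun k hk => ?_⟩
  have hsub : ({f 0, f 1, f 8} : Set ℝ) ⊆ Set.range f := by
    rintro _ (rfl | rfl | rfl) <;> exact ⟨_, rfl⟩
  have hc : ({f 0, f 1, f 8} : Set ℝ).ncard = 3 :=
    Set.ncard_eq_three.2 ⟨_, _, _, h01.ne', (hlt.trans h01).ne', hlt.ne', rfl⟩
  have heq := Set.eq_of_subset_of_ncard_le hsub (by rw [h3, hc]) (Set.toFinite _)
  have hmem : f k ∈ ({f 0, f 1, f 8} : Set ℝ) := heq ▸ Set.mem_range_self k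
  rcases hmem with h | h | h
  · exact absurd h (((hk1 k hk).trans_lt h01).ne)
  · exact Or.inl h
  · exact Or.inr h

/-- The place of the drop from `f 1` to `f 8` determines `f`. The exchange of 5 and 6 is visible
only when the drop falls between them. -/
theorem isThreeStep_comp {f : Fin 9 → ℝ} (hf : Antitone f)
    (h : f 8 < f 1 ∧ ∀ k, k ≠ 0 → f k = f 1 ∨ f k = f 8) {π : Equiv.Perm (Fin 9)}
    (hπ : π = 1 ∨ π = Equiv.swap 5 6) : IsThreeStep (f ∘ π) (f 0) (f 1) (f 8) := by
  obtain ⟨hlt, hk⟩ := h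
  have hstep : ∀ i j : Fin 9, i ≤ j → f i = f 8 → f j = f 8 := fun i j hij hi =>
    le_antisymm (hi ▸ hf hij) (hf (Fin.le_last j))
  have e5 : (Equiv.swap (5 : Fin 9) 6) 5 = 6 := by decide
  have e6 : (Equiv.swap (5 : Fin 9) 6) 6 = 5 := by decide
  have e (k : Fin 9) (hk : k ≠ 5) (hk' : k ≠ 6) : (Equiv.swap (5 : Fin 9) 6) k = k :=
    Equiv.swap_apply_of_ne_of_ne hk hk'
  have hx : f ∘ π = ![f 0, f 1, f 2, f 3, f 4, f 5, f 6, f 7, f 8] ∨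
      f ∘ π = ![f 0, f 1, f 2, f 3, f 4, f 6, f 5, f 7, f 8] := by
    rcases hπ with rfl | rfl
    · left; ext k; fin_cases k <;> rfl
    · right; ext k; fin_cases k <;> simp [e5, e6, e]
  have g2 := hk 2 (by decide)
  have g3 := (hk 3 (by decide)).imp_left fun h => (⟨h, g2.resolve_right fun h2 =>
    hlt.ne (by rw [← hstep 2 3 (by decide) h2, h])⟩ : f 3 = f 1 ∧ f 2 = f 1)
  have g4 := (hk 4 (by decide)).imp_left fun h => (⟨h, g3.resolve_right fun h2 =>
    hlt.ne (by rw [← hstep 3 4 (by decide) h2, h])⟩ : f 4 = f 1 ∧ f 3 = f 1 ∧ f 2 = f 1)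
  have g5 := (hk 5 (by decide)).imp_left fun h => And.intro h (g4.resolve_right fun h2 =>
    hlt.ne (by rw [← hstep 4 5 (by decide) h2, h]))
  have g6 := (hk 6 (by decide)).imp_left fun h => And.intro h (g5.resolve_right fun h2 =>
    hlt.ne (by rw [← hstep 5 6 (by decide) h2, h]))
  have g7 := (hk 7 (by decide)).imp_left fun h => And.intro h (g6.resolve_right fun h2 =>
    hlt.ne (by rw [← hstep 6 7 (by decide) h2, h]))
  rcases g7 with ⟨h7, h6, h5, h4, h3, h2⟩ | h7
  · rw [h7, h6, h5, h4, h3, h2, or_self_iff] at hx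
    exact .inr (.inr (.inr (.inr (.inr (.inr (.inr hx))))))
  rcases g6 with ⟨h6, h5, h4, h3, h2⟩ | h6
  · rw [h7, h6, h5, h4, h3, h2, or_self_iff] at hx
    exact .inr (.inr (.inr (.inr (.inr (.inr (.inl hx))))))
  rcases g5 with ⟨h5, h4, h3, h2⟩ | h5
  · rw [h7, h6, h5, h4, h3, h2] at hx
    exact .inr (.inr (.inr (.inr (hx.imp_right .inl))))
  rcases g4 with ⟨h4, h3, h2⟩ | h4
  · rw [h7, h6, h5, h4, h3, h2, or_self_iff] at hx
    exact .inr (.inr (.inr (.inl hx)))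
  rcases g3 with ⟨h3, h2⟩ | h3
  · rw [h7, h6, h5, h4, h3, h2, or_self_iff] at hx
    exact .inr (.inr (.inl hx))
  rcases g2 with h2 | h2
  · rw [h7, h6, h5, h4, h3, h2, or_self_iff] at hx
    exact .inr (.inl hx)
  · rw [h7, h6, h5, h4, h3, h2, or_self_iff] at hx
    exact .inl hx

open Matrix in
/-- Among the three-step vectors, only the exceptional one is singular at `(1, 1, 0)`. -/
theorem IsThreeStep.eq_of_singular {x : Fin 9 → ℝ} {a b c : ℝ} (hx : IsThreeStep x a b c)
    (hcb : c < b) {s : Fin 3 → ℝ} (hs0 : 0 < s 1) (hs : s 0 = s 1 ∧ s 2 = 0)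
    (hL : L1 x *ᵥ s = 0) : x = ![3 * c, b, b, b, b, b, c, c, c] := by
  rw [L1_mulVec_eq_zero_iff, hs.1, hs.2] at hL
  obtain ⟨e0, e1, e2⟩ := hL
  have f0 : 2 * x 8 + (x 7 - x 0) = 0 := by
    refine (mul_eq_zero.1 (?_ : _ * s 1 = 0)).resolve_right hs0.ne'
    linear_combination e0
  have f1 : 2 * x 6 + (x 7 - x 0) = 0 := by
    refine (mul_eq_zero.1 (?_ : _ * s 1 = 0)).resolve_right hs0.ne'
    linear_combination e1
  have f2 : (x 5 - x 1) + (x 4 - x 2) = 0 := by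
    refine (mul_eq_zero.1 (?_ : _ * s 1 = 0)).resolve_right hs0.ne'
    linear_combination e2
  -- The equations give `x 6 = x 8` and `x 4 + x 5 = x 1 + x 2`, which only the fifth shape
  -- satisfies; then `a = 3 * c`.
  rcases hx with h | h | h | h | h | h | h | h <;> rw [h] at f0 f1 f2 <;>
    simp at f0 f1 f2 <;> try linarith
  rw [h, show a = 3 * c by linarith]

open Matrix in
/-- Outside of the exceptional case the linear equations determine a three-step vector of sum
one. -/
theorem IsThreeStep.eq_of_L1_mulVec_eq_zero {x d : Fin 9 → ℝ} {a b c : ℝ}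
    (hx : IsThreeStep x a b c) (hc : 0 < c) (hcb : c < b) (hba : b < a) {s : Fin 3 → ℝ}
    (h01 : s 1 ≤ s 0) (h1 : 0 < s 1) (hne : ¬ (s 0 = s 1 ∧ s 2 = 0))
    (hLx : L1 x *ᵥ s = 0) (hLd : L1 d *ᵥ s = 0) (hd : ∀ i j, x i = x j → d i = d j)
    (hx1 : ∑ k, x k = 1) (hd1 : ∑ k, d k = 1) : d = x := by
  have h0 : 0 < s 0 := h1.trans_le h01
  have hb : 0 < b := hc.trans hcb
  have hxk : ∀ k, x k = x 0 ∨ x k = x 1 ∨ x k = x 8 := by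
    rcases hx with h | h | h | h | h | h | h | h <;> subst h <;> intro k <;> fin_cases k <;> simp
  -- Proportional vectors with the same sum are equal.
  suffices h : d 0 * x 8 = x 0 * d 8 ∧ d 1 * x 8 = x 1 * d 8 by
    have hk : ∀ k, d k * x 8 = x k * d 8 := fun k => by
      rcases hxk k with h' | h' | h'
      · rw [h', hd k 0 h', h.1]
      · rw [h', hd k 1 h', h.2]
      · rw [h', hd k 8 h', mul_comm]
    have h8 : x 8 = d 8 := by
      have := Finset.sum_congr rfl fun k (_ : k ∈ Finset.univ) => hk k
      rwa [← Finset.sum_mul, ← Finset.sum_mul, hd1, hx1, one_mul, one_mul] at this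
    have hx8 : x 8 ≠ 0 := by
      rcases hx with h' | h' | h' | h' | h' | h' | h' | h' <;> subst h' <;> exact hc.ne'
    ext k
    have := hk k
    rw [← h8] at this
    exact mul_right_cancel₀ hx8 this
  rw [L1_mulVec_eq_zero_iff] at hLx hLd
  obtain ⟨x0, x1, x2⟩ := hLx
  obtain ⟨d0, d1, d2⟩ := hLd
  have cancel : ∀ {u v : ℝ}, 0 < v → u * v = 0 → u = 0 := fun hv h =>
    (mul_eq_zero.1 h).resolve_right hv.ne'
  -- As `d` has the block pattern of `x`, both satisfy the same equations in three unknowns.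
  -- Eliminating between corresponding rows leaves a 2 × 2 minor times a positive factor.
  rcases hx with h | h | h | h | h | h | h | h <;> subst h
  · simp at x0 x1 x2
    rw [hd 2 8 rfl, hd 3 8 rfl, hd 4 8 rfl, hd 5 8 rfl, hd 6 8 rfl, hd 7 8 rfl] at *
    have k1 := cancel h0 (u := d 8 * a - d 0 * c) (by
      linear_combination c * d1 - d 8 * x1)
    have k2 := cancel h0 (u := d 8 * b - d 1 * c) (by
      linear_combination c * d2 - d 8 * x2)
    simp
    constructor <;> linarith
  · simp at x0 x1 x2
    rw [hd 2 1 rfl, hd 3 8 rfl, hd 4 8 rfl, hd 5 8 rfl, hd 6 8 rfl, hd 7 8 rfl] at *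
    have k2 := cancel (add_pos h0 h1) (u := d 8 * b - d 1 * c) (by
      linear_combination c * d2 - d 8 * x2)
    have k1 := cancel h0 (u := d 8 * a - d 0 * c) (by
      linear_combination c * d1 - d 8 * x1 - s 2 * k2)
    simp
    constructor <;> linarith
  · simp at x0 x1 x2
    rw [hd 2 1 rfl, hd 3 1 rfl, hd 4 8 rfl, hd 5 8 rfl, hd 6 8 rfl, hd 7 8 rfl] at *
    have k2 := cancel (add_pos h0 h1) (u := d 8 * b - d 1 * c) (by
      linear_combination b * d2 - d 1 * x2)
    have k1 := cancel h0 (u := d 8 * a - d 0 * c) (by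
      linear_combination c * d1 - d 8 * x1 - s 2 * k2)
    simp
    constructor <;> linarith
  · simp at x0 x1 x2
    rw [hd 2 1 rfl, hd 3 1 rfl, hd 4 1 rfl, hd 5 8 rfl, hd 6 8 rfl, hd 7 8 rfl] at *
    have k2 := cancel h0 (u := d 8 * b - d 1 * c) (by
      linear_combination b * d2 - d 1 * x2)
    have k1 := cancel h0 (u := d 8 * a - d 0 * c) (by
      linear_combination c * d1 - d 8 * x1)
    simp
    constructor <;> linarith
  · simp at x0 x1 x2
    -- In this shape the third row reads `2 * b * s 2 = 0` and the first two differ by `(c + a) * (s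
    -- 0 - s 1)`, so `s` would be a multiple of `(1, 1, 0)`.
    have s2 : s 2 = 0 := x2.resolve_left hb.ne'
    have k := cancel (hc.trans (hcb.trans hba) |> add_pos hc) (u := s 0 - s 1) (by
      linear_combination x0 - x1)
    exact absurd ⟨by linarith, s2⟩ hne
  · simp at x0 x1 x2
    rw [hd 2 1 rfl, hd 3 1 rfl, hd 4 1 rfl, hd 6 1 rfl, hd 5 8 rfl, hd 7 8 rfl] at *
    have k2 := cancel h0 (u := d 8 * b - d 1 * c) (by
      linear_combination b * d2 - d 1 * x2)
    have k1 := cancel h0 (u := d 8 * a - d 0 * c) (by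
      linear_combination c * d1 - d 8 * x1 + 2 * s 1 * k2)
    simp
    constructor <;> linarith
  · simp at x0 x1 x2
    rw [hd 2 1 rfl, hd 3 1 rfl, hd 4 1 rfl, hd 5 1 rfl, hd 6 1 rfl, hd 7 8 rfl] at *
    have k1 := cancel h1 (u := d 8 * a - d 0 * c) (by
      linear_combination c * d0 - d 8 * x0)
    have k2 := cancel h1 (u := d 8 * b - d 1 * c) (by
      linear_combination -(c / 2) * d1 + d 8 / 2 * x1 + s 0 / 2 * k1)
    simp
    constructor <;> linarith
  · simp at x0 x1 x2
    rw [hd 2 1 rfl, hd 3 1 rfl, hd 4 1 rfl, hd 5 1 rfl, hd 6 1 rfl, hd 7 1 rfl] at *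
    have k0 := cancel h0 (u := d 1 * a - d 0 * b) (by
      linear_combination b * d1 - d 1 * x1)
    have k2 := cancel h0 (u := d 8 * b - d 1 * c) (by
      linear_combination b / 2 * d0 - d 1 / 2 * x0 - s 1 / 2 * k0)
    have k1 := cancel hb (u := d 8 * a - d 0 * c) (by
      linear_combination c * k0 + a * k2)
    simp
    constructor <;> linarith

/-! ### The exceptional family -/

open Matrix in
theorem star_mul_conj_mul {n : Type*} [Fintype n] [DecidableEq n] {V : Matrix n n ℂ}
    (hV : V ∈ unitaryGroup n ℂ) (A : Matrix n n ℂ) : star V * (V * A * star V) * V = A := by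
  have h := mem_unitaryGroup_iff'.1 hV
  simp only [mul_assoc, h, mul_one]
  rw [← mul_assoc, h, one_mul]

open Matrix in
theorem star_conj_injective {n : Type*} [Fintype n] [DecidableEq n] {V : Matrix n n ℂ}
    (hV : V ∈ unitaryGroup n ℂ) {A B : Matrix n n ℂ} (h : star V * A * V = star V * B * V) :
    A = B := by
  have h1 : ∀ A : Matrix n n ℂ, V * (star V * A * V) * star V = A := fun A => by
    simpa only [star_star] using star_mul_conj_mul (Unitary.star_mem hV) A
  rw [← h1 A, h, h1 B]

/-- The exceptional eigenvalue vectors are nonnegative for both orderings of the weights. -/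
theorem schmidtForm_exceptional_nonneg {b c : ℝ} (hc : 0 < c) (hcb : c ≤ b) (hb : b ≤ 3 * c)
    (s : Fin 3 → ℝ) : 0 ≤ schmidtForm ![3 * c, b, b, b, b, b, c, c, c] s ∧
      0 ≤ schmidtForm (![3 * c, b, b, b, b, b, c, c, c] ∘ Equiv.swap 5 6) s := by
  have hb0 : 0 < b := hc.trans_le hcb
  constructor
  · rw [schmidtForm_eq]
    simp
    have : 0 ≤ c * (s 0 - s 1) ^ 2 + b * s 2 ^ 2 := by positivity
    linarith
  · have hx : (![3 * c, b, b, b, b, b, c, c, c] : Fin 9 → ℝ) ∘ Equiv.swap 5 6 =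
        ![3 * c, b, b, b, b, c, b, c, c] := by
      have e5 : (Equiv.swap (5 : Fin 9) 6) 5 = 6 := by decide
      have e6 : (Equiv.swap (5 : Fin 9) 6) 6 = 5 := by decide
      have e (k : Fin 9) (hk : k ≠ 5) (hk' : k ≠ 6) : (Equiv.swap (5 : Fin 9) 6) k = k :=
        Equiv.swap_apply_of_ne_of_ne hk hk'
      ext k
      fin_cases k <;> simp [e5, e6, e]
    rw [hx, schmidtForm_eq]
    simp
    -- Completing squares in `s 1` and `s 2` in `b` times the form; the remainder is nonnegative
    -- because `c ≤ b ≤ 3 * c`.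
    have h1 : 0 ≤ (b * s 1 - c * s 0) ^ 2 + (b * s 2 - (b - c) * s 0 / 2) ^ 2 +
        (b - c) * (5 * c - b) / 4 * s 0 ^ 2 := by
      have : 0 ≤ (b - c) * (5 * c - b) := mul_nonneg (by linarith) (by linarith)
      positivity
    refine nonneg_of_mul_nonneg_right (a := b) ?_ hb0
    linarith

open Matrix in
theorem conj_exceptional_mem_absolutelyPPT {b c : ℝ} (hc : 0 < c) (hcb : c ≤ b) (hb : b ≤ 3 * c)
    (h1 : 6 * c + 5 * b = 1) {V : Matrix (Fin 3 × Fin 3) (Fin 3 × Fin 3) ℂ}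
    (hV : V ∈ unitaryGroup (Fin 3 × Fin 3) ℂ) :
    V * diagonal (fun p =>
      ((![3 * c, b, b, b, b, b, c, c, c] : Fin 9 → ℝ) (pairEquiv.symm p) : ℂ)) * star V ∈ absolutelyPPT 3 3 := by
  have hanti : Antitone (![3 * c, b, b, b, b, b, c, c, c] : Fin 9 → ℝ) :=
    Fin.antitone_iff_succ_le.2 fun i => by fin_cases i <;> simp <;> assumption
  refine conj_diagonal_mem_absolutelyPPT hanti (fun k => ?_) ?_ (fun s _ _ =>
    ⟨fun _ => (schmidtForm_exceptional_nonneg hc hcb hb s).1,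
      fun _ => (schmidtForm_exceptional_nonneg hc hcb hb s).2⟩) hV
  · exact hc.le.trans (hanti (Fin.le_last k))
  · simp [Fin.sum_univ_succ]
    linarith

open Matrix in
theorem exists_midpoint_of_exceptional {ρ : Matrix (Fin 3 × Fin 3) (Fin 3 × Fin 3) ℂ}
    (h : ρ.IsHermitian) (ht : ρ.trace = 1) (he : IsExceptional (eigenvalueVector h)) :
    ∃ α ∈ absolutelyPPT 3 3, ∃ β ∈ absolutelyPPT 3 3, α ≠ β ∧ ρ = midpoint ℝ α β := by
  obtain ⟨⟨b, c, hc, hcb, hb, hx⟩, -⟩ := he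
  have hsum := sum_eigenvalueVector h ht
  have h1 : 6 * c + 5 * b = 1 := by
    rw [hx] at hsum
    simp [Fin.sum_univ_succ] at hsum
    linarith
  obtain ⟨V, hV, hρ⟩ := exists_unitary_conj_eigenvalueVector h 1
  simp only [hx, Equiv.Perm.one_apply] at hρ
  -- The pair `(c, b)` moves by `±(δ, -6 * δ / 5)`, preserving `6 * c + 5 * b = 1`. The two bounds
  -- keep `c ≤ b` and `b ≤ 3 * c`; the second also keeps `c - δ` positive.
  set δ : ℝ := min ((b - c) / 3) ((3 * c - b) / 5) with hδ
  have hδ0 : 0 < δ := lt_min (by linarith) (by linarith)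
  have hδ1 : δ ≤ (b - c) / 3 := min_le_left _ _
  have hδ2 : δ ≤ (3 * c - b) / 5 := min_le_right _ _
  have hα := conj_exceptional_mem_absolutelyPPT (b := b - 6 * δ / 5) (c := c + δ) (by linarith)
    (by linarith) (by linarith) (by linarith) hV
  have hβ := conj_exceptional_mem_absolutelyPPT (b := b + 6 * δ / 5) (c := c - δ) (by linarith)
    (by linarith) (by linarith) (by linarith) hV
  refine ⟨_, hα, _, hβ, fun heq => ?_, ?_⟩
  · have h2 := congrArg (fun A => star V * A * V) heq
    simp only [star_mul_conj_mul hV] at h2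
    have h3 := congrFun (congrFun h2 (pairEquiv 8)) (pairEquiv 8)
    rw [diagonal_apply_eq, diagonal_apply_eq, Equiv.symm_apply_apply, Complex.ofReal_inj] at h3
    simp at h3
    linarith
  · rw [hρ, midpoint_eq_smul_add, ← add_mul, ← mul_add, diagonal_add, ← smul_mul_assoc,
      ← mul_smul_comm]
    congr 2
    ext p q
    rcases eq_or_ne p q with rfl | hpq
    · rw [Matrix.smul_apply, diagonal_apply_eq, diagonal_apply_eq]
      generalize pairEquiv.symm p = k
      rw [← Complex.ofReal_add, ← Complex.coe_smul, smul_eq_mul, ← Complex.ofReal_mul,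
        Complex.ofReal_inj]
      fin_cases k <;> simp <;> ring
    · simp [hpq]

/-! ### Extremality and the conclusion -/

open Matrix in
/-- Away from the exceptional case, boundary points of full rank with three distinct eigenvalues
and simple largest eigenvalue are the only points of any segment through them. -/
theorem IsBoundaryPoint.eq_of_convex_combination {ρ : Matrix (Fin 3 × Fin 3) (Fin 3 × Fin 3) ℂ}
    (hρ : IsBoundaryPoint ρ) (hfull : ρ.rank = 9)
    (hthree : (Set.range (eigenvalueVector hρ.isHermitian)).ncard = 3)
    (hsimple : eigenvalueVector hρ.isHermitian 1 < eigenvalueVector hρ.isHermitian 0)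
    (hexc : ¬ IsExceptional (eigenvalueVector hρ.isHermitian))
    {α β : Matrix (Fin 3 × Fin 3) (Fin 3 × Fin 3) ℂ} (hα : α ∈ absolutelyPPT 3 3)
    (hβ : β ∈ absolutelyPPT 3 3) {a b : ℝ} (ha : 0 < a) (hb : 0 < b)
    (hab : a • α + b • β = ρ) : α = ρ := by
  obtain ⟨s, ⟨hs, hs0, hs1⟩, π, hπ, hform⟩ := hρ.exists_schmidtForm_nonpos hfull
  have hpos : ∀ k, 0 < eigenvalueVector hρ.isHermitian k := eigenvalueVector_pos hρ.1.1.1.1 hfull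
  have hanti := eigenvalueVector_antitone hρ.isHermitian
  have hsum := sum_eigenvalueVector hρ.isHermitian hρ.1.1.1.2
  obtain ⟨V, hV, hVρ⟩ := exists_unitary_conj_eigenvalueVector hρ.isHermitian π
  generalize eigenvalueVector hρ.isHermitian = l at *
  have hl := eq_or_eq_of_ncard_range_eq_three hanti hsimple hthree
  have hstep := isThreeStep_comp hanti hl hπ
  have hconj : ∀ {A : Matrix (Fin 3 × Fin 3) (Fin 3 × Fin 3) ℂ}, A ∈ absolutelyPPT 3 3 →
      star V * A * V ∈ absolutelyPPT 3 3 := fun hA => by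
    simpa only [star_star] using unitary_conj_mem_absolutelyPPT hA (Unitary.star_mem hV)
  have hX : star V * ρ * V = diagonal (fun p => ((l ∘ π) (pairEquiv.symm p) : ℂ)) := by
    rw [hVρ, star_mul_conj_mul hV]
    rfl
  have hnonneg : ∀ t, 0 ≤ schmidtForm (l ∘ π) t := fun t => by
    have h := schmidtForm_diagVector_nonneg (hconj hρ.1) t
    have hd : diagVector (star V * ρ * V) = l ∘ π := by
      ext k
      simp [diagVector, hX]
    rwa [hd] at h
  have hform0 : schmidtForm (l ∘ π) s = 0 := le_antisymm hform (hnonneg s)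
  have h01 : s 1 ≤ s 0 := hs (by decide)
  have h12 : s 2 ≤ s 1 := hs (by decide)
  -- Otherwise `s = (1, 0, 0)`, where the form equals an eigenvalue, positive by full rank.
  have hs1pos : 0 < s 1 := by
    refine (hs0 1).lt_of_ne' fun h1 => ?_
    have h2 : s 2 = 0 := le_antisymm (h1 ▸ h12) (hs0 2)
    rw [schmidtForm_eq, h1, h2] at hform0
    rw [h1, h2] at hs1
    have h3 : s 0 ^ 2 = 1 := by linarith
    rw [h3] at hform0
    exact (hpos (π 8)).ne' (by simpa using hform0)
  have hne : ¬ (s 0 = s 1 ∧ s 2 = 0) := by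
    intro h
    have hLx := L1_mulVec_eq_zero_of_schmidtForm hnonneg hform0
    have hx := hstep.eq_of_singular hl.1 hs1pos h hLx
    have hlx : l = ![3 * l 8, l 1, l 1, l 1, l 1, l 1, l 8, l 8, l 8] := by
      rcases hπ with rfl | rfl
      · exact hx
      -- For the exchanged ordering the singular shape would give `l 6 = l 1` and `l 5 = l 8`,
      -- against monotonicity.
      · have h5 := congrFun hx 5
        have h6 := congrFun hx 6
        rw [Function.comp_apply, Equiv.swap_apply_left] at h5
        rw [Function.comp_apply, Equiv.swap_apply_right] at h6
        simp at h5 h6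
        have h56 : l 6 ≤ l 5 := hanti (by decide)
        exact absurd hl.1 (not_lt.2 (by rw [← h5, ← h6]; exact h56))
    refine hexc ⟨⟨l 1, l 8, hpos 8, hl.1, ?_, hlx⟩, ?_⟩
    · have h0 := congrFun hlx 0
      simp at h0
      rwa [← h0]
    · rw [l1, hlx, L1, det_fin_three]
      simp
      ring
  obtain ⟨hLx, hLY, hconst, hoff⟩ := diagonal_of_convex_combination hX (hconj hρ.1) (hconj hα)
    (hconj hβ) ha hb (by
      rw [← hab, mul_add, add_mul, mul_smul_comm, smul_mul_assoc, mul_smul_comm, smul_mul_assoc])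
    hform0 fun i j hij =>
      L1_single_sub_single_mulVec_ne_zero h01 h12 (hs0 2) hs1pos hne hij
  have hαs := (hconj hα).1.1
  have hd1 : ∑ k, diagVector (star V * α * V) k = 1 := by
    have := congrArg Complex.re hαs.2
    rw [trace, Complex.re_sum, ← pairEquiv.sum_comp] at this
    exact this
  have hd := hstep.eq_of_L1_mulVec_eq_zero (hpos 8) hl.1 hsimple h01 hs1pos hne hLx hLY hconst
    ((Equiv.sum_comp π l).trans hsum) hd1
  refine star_conj_injective hV ?_
  rw [hX]
  ext p q
  rcases eq_or_ne p q with rfl | hpq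
  · rw [diagonal_apply_eq, ← hd]
    apply Complex.ext
    · simp [diagVector]
    · have := congrArg Complex.im (hαs.1.isHermitian.apply p p)
      simp at this
      rw [Complex.ofReal_im]
      linarith
  · rw [diagonal_apply_ne _ hpq]
    simpa using hoff (pairEquiv.symm p) (pairEquiv.symm q) (pairEquiv.symm.injective.ne hpq)

theorem mainTheorem2 (ρ : Matrix (Fin 3 × Fin 3) (Fin 3 × Fin 3) ℂ)
    (hρ : IsBoundaryPoint ρ)
    (hfull : ρ.rank = 9)
    (hthree : (Set.range (eigenvalueVector hρ.isHermitian)).ncard = 3)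
    (hsimple : eigenvalueVector hρ.isHermitian 1 < eigenvalueVector hρ.isHermitian 0) :
    (¬ IsExceptional (eigenvalueVector hρ.isHermitian) →
      ρ ∈ Set.extremePoints ℝ (absolutelyPPT 3 3)) ∧
    (IsExceptional (eigenvalueVector hρ.isHermitian) →
      (∃ α ∈ absolutelyPPT 3 3, ∃ β ∈ absolutelyPPT 3 3, α ≠ β ∧ ρ = midpoint ℝ α β) ∧
      ρ ∉ Set.extremePoints ℝ (absolutelyPPT 3 3)) := by
  refine ⟨fun hexc => ⟨hρ.1, ?_⟩, fun hexc => ?_⟩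
  · rintro α hα β hβ ⟨a, b, ha, hb, -, hab⟩
    exact hρ.eq_of_convex_combination hfull hthree hsimple hexc hα hβ ha hb hab
  · have hmid := exists_midpoint_of_exceptional hρ.isHermitian hρ.1.1.1.2 hexc
    refine ⟨hmid, fun hext => ?_⟩
    obtain ⟨α, hα, β, hβ, hne, hm⟩ := hmid
    have hseg : ρ ∈ openSegment ℝ α β := hm ▸ midpoint_mem_openSegment α β
    have h1 := hext.2 hα hβ hseg
    have h2 := hext.2 hβ hα (openSegment_symm ℝ α β ▸ hseg)
    exact hne (h1.trans h2.symm)
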